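/- Let $n\ge 2$ be an integer and let $G$ be a finite nontrivial abelian group (written additively). For a set $X$ let $X^{(k)}$ be the set of $k$-tuples of pairwise distinct elements of $X$. Let $L_n$ be the first-order language with $n+1$ sorts $I=P_1,P_2,\dots,P_n=P$ and $G$, function symbols $\pi^k_i:P_k\to P_{k-1}$ ($2\le k\le n$, $1\le i\le k$), $+:G\times G\to G$, $+:G\times P\to P$ and $\iota_\sigma:P\to P$ ($\sigma\in S_n$), and an $(n+1)$-ary relation symbol $Q$ on $P$. Let $\mathcal{H}_{G,n}$ be the following $L_n$-structure: $I=\omega$; $P_k=\omega^{(k)}$ for $2\le k<n$; $P=\omega^{(n)}\times G$; the sort $G$ is the group $G$ with its addition; $\pi^k_i(a_1,\dots,a_k)=(a_1,\dots,\widehat{a_i},\dots,a_k)$ for $k<n$ and $\pi^n_i((a_1,\dots,a_n),g)=(a_1,\dots,\widehat{a_i},\dots,a_n)$; $((a_1,\dots,a_n),g)+h=((a_1,\dots,a_n),g+h)$; $\iota_\sigma((a_1,\dots,a_n),g)=((a_{\sigma(1)},\dots,a_{\sigma(n)}),\operatorname{sign}(\sigma)\,g)$; and $Q(f_1,\dots,f_{n+1})$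 holds if and only if there are $(a_1,\dots,a_{n+1})\in\omega^{(n+1)}$ and $g_1,\dots,g_{n+1}\in G$ such that $f_i=((a_1,\dots,\widehat{a_i},\dots,a_{n+1}),g_i)$ for all $i$ and $\sum_{i=1}^{n+1}(-1)^i g_i=0$. Let $T_{G,n}$ be the complete $L_n$-theory of $\mathcal{H}_{G,n}$. Proposition. After naming every element of $G$ by a constant symbol (that is, passing to the complete theory of $(\mathcal{H}_{G,n},g)_{g\in G}$), the theory $T_{G,n}$ has weak elimination of imaginaries, that is, elimination of imaginaries up to names for finite sets: for every model $M$ of this theory, every equivalence relation $E$ on a finite product of sorts of $M$ that is definable without parameters, and every $E$-class $e$, there are a formula $\psi(x,z)$ without parameters, with $z$ a finite tuple of variables ranging over sorts of $M$, and a nonempty finite set $C$ of tuples from $M$ of the sorts of $z$, such that for every tuple $c$ of these sorts, $\psi(x,c)$ defines the class $e$ if and only if $c\in C$. -/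

import Mathlib

/-! ## Many-sorted first-order logic

Mathlib only has one-sorted first-order languages, so the many-sorted notions are set up here,
following Mathlib's `FirstOrder.Language` (terms, bounded formulas, realization, theories). -/

universe u

/-- A many-sorted first-order language: a type of sorts, function symbols (constants are function
symbols of arity `0`) and relation symbols, each with its arity and the sorts of its arguments. -/
structure MSLanguage where
  Sorts : Type
  Fn : Type
  fnArity : Fn → ℕ
  fnDom : (f : Fn) → Fin (fnArity f) → Sorts
  fnCod : Fn → Sorts
  Rel : Type
  relArity : Rel → ℕ
  relDom : (r : Rel) → Fin (relArity r) → Sorts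

namespace MSLanguage

/-- A structure for a many-sorted language. -/
structure Struc (L : MSLanguage) where
  carrier : L.Sorts → Type u
  funMap : (f : L.Fn) → ((i : Fin (L.fnArity f)) → carrier (L.fnDom f i)) → carrier (L.fnCod f)
  relMap : (r : L.Rel) → ((i : Fin (L.relArity r)) → carrier (L.relDom r i)) → Prop

/-- Terms whose variables are indexed by `α`, the variable `i` having sort `Γ i`; the last index
is the sort of the term. -/
inductive Term (L : MSLanguage) {α : Type} (Γ : α → L.Sorts) : L.Sorts → Type
  | var (i : α) : Term L Γ (Γ i)
  | func (f : L.Fn) (ts : (i : Fin (L.fnArity f)) → Term L Γ (L.fnDom f i)) :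
      Term L Γ (L.fnCod f)

/-- Formulas with free variables of sorts `Γ i`, `i : α`, and `m` further variables
of sorts `Δ j`, `j : Fin m`, which may get bound. A universal quantifier over the sort `s` binds
variable `0` of the `m + 1` variables of sorts `s, Δ 0, …, Δ (m - 1)`. -/
inductive BoundedFormula (L : MSLanguage) {α : Type} (Γ : α → L.Sorts) :
    {m : ℕ} → (Fin m → L.Sorts) → Type
  | falsum {m : ℕ} {Δ : Fin m → L.Sorts} : BoundedFormula L Γ Δ
  | equal {m : ℕ} {Δ : Fin m → L.Sorts} (s : L.Sorts) (t₁ t₂ : L.Term (Sum.elim Γ Δ) s) :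
      BoundedFormula L Γ Δ
  | rel {m : ℕ} {Δ : Fin m → L.Sorts} (r : L.Rel)
      (ts : (i : Fin (L.relArity r)) → L.Term (Sum.elim Γ Δ) (L.relDom r i)) :
      BoundedFormula L Γ Δ
  | imp {m : ℕ} {Δ : Fin m → L.Sorts} (φ ψ : BoundedFormula L Γ Δ) : BoundedFormula L Γ Δ
  | all {m : ℕ} {Δ : Fin m → L.Sorts} (s : L.Sorts)
      (φ : BoundedFormula L Γ (Fin.cons s Δ : Fin (m + 1) → L.Sorts)) : BoundedFormula L Γ Δ

/-- Formulas in the free variables `i : α`, the variable `i` having sort `Γ i`. -/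
abbrev Formula (L : MSLanguage) {α : Type} (Γ : α → L.Sorts) : Type :=
  L.BoundedFormula Γ (Fin.elim0 : Fin 0 → L.Sorts)

/-- Sentences: formulas without free variables. -/
abbrev Sentence (L : MSLanguage) : Type :=
  L.Formula (Empty.elim : Empty → L.Sorts)

/-- Theories: sets of sentences. -/
abbrev Theory (L : MSLanguage) : Type := Set L.Sentence

variable {L : MSLanguage}

/-- `M.Tuple Γ` is the product of the sorts `M (Γ i)`: the tuples of elements of `M` whose
`i`-th entry has sort `Γ i`. -/
abbrev Struc.Tuple (M : L.Struc) {α : Type} (Γ : α → L.Sorts) : Type _ :=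
  (i : α) → M.carrier (Γ i)

/-- The concatenation of two tuples. -/
def Struc.Tuple.append {M : L.Struc} {α β : Type} {Γ : α → L.Sorts} {Δ : β → L.Sorts}
    (x : M.Tuple Γ) (y : M.Tuple Δ) : M.Tuple (Sum.elim Γ Δ)
  | Sum.inl i => x i
  | Sum.inr j => y j

/-- The tuple `y` with the element `a` put in front. -/
def Struc.Tuple.cons {M : L.Struc} {m : ℕ} {s : L.Sorts} {Δ : Fin m → L.Sorts}
    (a : M.carrier s) (y : M.Tuple Δ) : M.Tuple (Fin.cons s Δ : Fin (m + 1) → L.Sorts) :=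
  Fin.cons (α := fun i => M.carrier ((Fin.cons s Δ : Fin (m + 1) → L.Sorts) i)) a y

/-- The value of a term. -/
def Term.realize (M : L.Struc) {α : Type} {Γ : α → L.Sorts} (v : M.Tuple Γ) :
    {s : L.Sorts} → L.Term Γ s → M.carrier s
  | _, .var i => v i
  | _, .func f ts => M.funMap f fun i => (ts i).realize M v

/-- Truth of a formula in `M` (Tarski's definition). -/
def BoundedFormula.Realize (M : L.Struc) {α : Type} {Γ : α → L.Sorts} (v : M.Tuple Γ) :
    {m : ℕ} → {Δ : Fin m → L.Sorts} → L.BoundedFormula Γ Δ → M.Tuple Δ → Prop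
  | _, _, .falsum, _ => False
  | _, _, .equal _ t₁ t₂, y =>
      t₁.realize M (Struc.Tuple.append v y) = t₂.realize M (Struc.Tuple.append v y)
  | _, _, .rel r ts, y => M.relMap r fun i => (ts i).realize M (Struc.Tuple.append v y)
  | _, _, .imp φ ψ, y => φ.Realize M v y → ψ.Realize M v y
  | _, _, .all s φ, y => ∀ a : M.carrier s, φ.Realize M v (Struc.Tuple.cons a y)

/-- `φ.Holds M v`: the formula `φ` is true of the tuple `v` in `M`. -/
def Formula.Holds (M : L.Struc) {α : Type} {Γ : α → L.Sorts} (φ : L.Formula Γ)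
    (v : M.Tuple Γ) : Prop :=
  BoundedFormula.Realize M v φ fun i => i.elim0

/-- The sentence `φ` is true in `M`. -/
def Struc.Satisfies (M : L.Struc) (φ : L.Sentence) : Prop :=
  Formula.Holds M φ fun i => i.elim

/-- `M` is a model of `T`. -/
def Struc.IsModel (M : L.Struc) (T : L.Theory) : Prop :=
  ∀ φ ∈ T, M.Satisfies φ

/-- The complete theory of `M`. -/
def Struc.completeTheory (M : L.Struc) : L.Theory :=
  {φ | M.Satisfies φ}

/-- The language `L` with a new constant symbol of sort `srt c` for each `c : C`. -/
def addConstants (L : MSLanguage) (C : Type) (srt : C → L.Sorts) : MSLanguage where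
  Sorts := L.Sorts
  Fn := L.Fn ⊕ C
  fnArity
    | Sum.inl f => L.fnArity f
    | Sum.inr _ => 0
  fnDom
    | Sum.inl f => L.fnDom f
    | Sum.inr _ => Fin.elim0
  fnCod
    | Sum.inl f => L.fnCod f
    | Sum.inr c => srt c
  Rel := L.Rel
  relArity := L.relArity
  relDom := L.relDom

/-- The expansion of `M` in which the new constant symbol `c` names the element `val c`. -/
def Struc.nameConstants (M : L.Struc) {C : Type} {srt : C → L.Sorts}
    (val : (c : C) → M.carrier (srt c)) : (L.addConstants C srt).Struc where
  carrier := M.carrier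
  funMap
    | Sum.inl f => M.funMap f
    | Sum.inr c => fun _ => val c
  relMap := M.relMap

/-- Weak elimination of imaginaries (elimination of imaginaries up to names for finite sets).

In every model `M` of `T`, every imaginary `e` (the class of a finite tuple `a` modulo an
equivalence relation `E` that is definable without parameters on a finite product of sorts) is
interdefinable with a nonempty finite set `C` of finite tuples from the sorts of `M`: for some
formula `ψ(x, z)` without parameters, the class `e` is defined by `ψ(x, c)` for each `c ∈ C`, and
`C` consists of all the tuples `c` for which `ψ(x, c)` defines `e`. -/
def Theory.WeakElimImaginaries (T : L.Theory) : Prop :=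
  ∀ M : Struc.{u} L, M.IsModel T →
    ∀ (k : ℕ) (Γ : Fin k → L.Sorts) (E : L.Formula (Sum.elim Γ Γ)),
      Equivalence (fun x y : M.Tuple Γ => E.Holds M (Struc.Tuple.append x y)) →
      ∀ a : M.Tuple Γ,
        ∃ (l : ℕ) (Δ : Fin l → L.Sorts) (ψ : L.Formula (Sum.elim Γ Δ)) (C : Set (M.Tuple Δ)),
          C.Finite ∧ C.Nonempty ∧
          ∀ c : M.Tuple Δ,
            c ∈ C ↔
              {x : M.Tuple Γ | ψ.Holds M (Struc.Tuple.append x c)} =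
                {x : M.Tuple Γ | E.Holds M (Struc.Tuple.append x a)}

end MSLanguage

/-! ## The language `L_n`, the structure `H_{G,n}` and its theory

The arity is `n = m + 2`, so that `m : ℕ` ranges over all `n ≥ 2`. -/

namespace Polygroupoid

/-- The `n + 1` sorts of `L_n`, `n = m + 2`: `low k` is `P_{k+1}` for `k = 0, …, m`, that is
`I = P_1, P_2, …, P_{n-1}`; `top` is `P = P_n`; and `grp` is `G`. -/
inductive Srt (m : ℕ) : Type
  | low (k : Fin (m + 1))
  | top
  | grp

/-- The function symbols of `L_n`, `n = m + 2`. With indices starting from `0`: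
* `projLow k i` is the `i`-th coordinate of `π^{k+2} : P_{k+2} → (P_{k+1})^{k+2}`, `k + 2 < n`;
* `projTop i` is the `i`-th coordinate of `π^n : P_n → (P_{n-1})^n`;
* `add` is the group operation `G × G → G`;
* `act` is the action `G × P → P`;
* `inv σ` is `ι_σ : P → P`. -/
inductive Fn (m : ℕ) : Type
  | projLow (k : Fin m) (i : Fin (k + 2))
  | projTop (i : Fin (m + 2))
  | add
  | act
  | inv (σ : Equiv.Perm (Fin (m + 2)))

/-- The language `L_n`, `n = m + 2`; its only relation symbol is the `(n + 1)`-ary symbol `Q`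
on the sort `P`. -/
def language (m : ℕ) : MSLanguage where
  Sorts := Srt m
  Fn := Fn m
  fnArity
    | .projLow _ _ => 1
    | .projTop _ => 1
    | .add => 2
    | .act => 2
    | .inv _ => 1
  fnDom
    | .projLow k _ => fun _ => .low k.succ
    | .projTop _ => fun _ => .top
    | .add => fun _ => .grp
    | .act => ![.grp, .top]
    | .inv _ => fun _ => .top
  fnCod
    | .projLow k _ => .low k.castSucc
    | .projTop _ => .low (Fin.last m)
    | .add => .grp
    | .act => .top
    | .inv _ => .top
  Rel := Unit
  relArity _ := m + 3
  relDom _ _ := .top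

/-- The `i`-th face `(a_1, …, â_i, …, a_{k+1})` of a tuple of distinct natural numbers. -/
def face {k : ℕ} (i : Fin (k + 1)) (a : Fin (k + 1) ↪ ℕ) : Fin k ↪ ℕ :=
  i.succAboveEmb.trans a

/-- The sorts of `H_{G,n}`: `P_k` is the set `ω^{(k)}` of `k`-tuples of distinct elements of `ω`
for `k < n` (in particular `I = P_1` is `ω`, regarded as `ω^{(1)}`), and `P_n = ω^{(n)} × G`. -/
def carrier (G : Type) (m : ℕ) : Srt m → Type
  | .low k => Fin (k + 1) ↪ ℕ
  | .top => (Fin (m + 2) ↪ ℕ) × G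
  | .grp => G

/-- The operation of `G`. -/
def addMap {G : Type} [AddCommGroup G] (g h : G) : G :=
  g + h

/-- The action of `G` on `P_n`: `((a_1, …, a_n), g) + h = ((a_1, …, a_n), g + h)`. -/
def actMap {G : Type} [AddCommGroup G] {m : ℕ} (h : G) (f : (Fin (m + 2) ↪ ℕ) × G) :
    (Fin (m + 2) ↪ ℕ) × G :=
  (f.1, f.2 + h)

/-- `ι_σ((a_1, …, a_n), g) = ((a_{σ(1)}, …, a_{σ(n)}), sign(σ) g)`. -/
def invMap {G : Type} [AddCommGroup G] {m : ℕ} (σ : Equiv.Perm (Fin (m + 2)))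
    (f : (Fin (m + 2) ↪ ℕ) × G) : (Fin (m + 2) ↪ ℕ) × G :=
  (σ.toEmbedding.trans f.1, ((Equiv.Perm.sign σ : ℤˣ) : ℤ) • f.2)

/-- The relation `Q(f_1, …, f_{n+1})`: there are distinct `a_1, …, a_{n+1}` such that
`f_i = ((a_1, …, â_i, …, a_{n+1}), g_i)` for all `i`, and `∑ (-1)^i g_i = 0`. -/
def QRel {G : Type} [AddCommGroup G] {m : ℕ} (f : Fin (m + 3) → (Fin (m + 2) ↪ ℕ) × G) : Prop :=
  (∃ a : Fin (m + 3) ↪ ℕ, ∀ i, (f i).1 = face i a) ∧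
    ∑ i : Fin (m + 3), (-1 : ℤ) ^ ((i : ℕ) + 1) • (f i).2 = 0

/-- The standard structure `H_{G,n}`, `n = m + 2`. -/
def standardModel (G : Type) [AddCommGroup G] (m : ℕ) : (language m).Struc where
  carrier := carrier G m
  funMap
    | .projLow _ i => fun x => face i (x (0 : Fin 1))
    | .projTop i => fun x => face i (Prod.fst (x (0 : Fin 1)))
    | .add => fun x => addMap (G := G) (x (0 : Fin 2)) (x (1 : Fin 2))
    | .act => fun x => actMap (G := G) (x (0 : Fin 2)) (x (1 : Fin 2))
    | .inv σ => fun x => invMap (G := G) σ (x (0 : Fin 1))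
  relMap _ f := QRel (G := G) f

/-- `T_{G,n}`, `n = m + 2`: the complete `L_n`-theory of `H_{G,n}`. -/
def theory (G : Type) [AddCommGroup G] (m : ℕ) : (language m).Theory :=
  (standardModel G m).completeTheory

/-- The language `L_n` with a constant symbol of sort `G` for each element of the group `G`. -/
def namedLanguage (G : Type) (m : ℕ) : MSLanguage :=
  (language m).addConstants G fun _ => Srt.grp

/-- `T_{G,n}` after naming constants for the elements of `G`: the complete theory of the
expansion of `H_{G,n}` in which each `g : G` is named by its constant symbol. -/
def namedTheory (G : Type) [AddCommGroup G] (m : ℕ) : (namedLanguage G m).Theory :=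
  ((standardModel G m).nameConstants (C := G) (srt := fun _ => Srt.grp)
    fun g => (g : carrier G m Srt.grp)).completeTheory

end Polygroupoid

/-!
Write `H` for the standard structure with constants for the elements of `G`. Its automorphisms are
the permutations of the vertices `ω` combined with the translations of the fibres of `P_n` by
alternating `(n - 1)`-cocycles of the full simplex on `ω`, and this simplex is acyclic, so that
all these cocycles are coboundaries. The support of a point of `H` is the finite set of vertices
that occur in it. Three facts about supports are used.

* The points over a finite set `D` form a finite structure, and every copy of it in `H`, that is,
  every map that commutes with the function symbols, preserves `Q` and is injective on vertices,
  is the restriction of an automorphism (`IsCopyOn.exists_aut`). Being a copy is expressed by one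
  formula (`exists_formula_copy`).
* The automorphisms that fix all points over `A ∩ B` are generated by those that fix all points
  over `A` and those that fix all points over `B` (`fixing_inter_le`). For the translations of the
  fibres this is acyclicity relative to a full subsimplex (`IsAlternating.exists_primitive`): a
  cocycle that vanishes over `A ∩ B` is the coboundary of a cochain that vanishes there, and this
  cochain can be cut off outside `A`.
* Tuples of given sorts can all be moved over one finite set (`exists_aut_supp_subset`).

By the second fact, the stabilizer `K` of the class `e` of a tuple `a` over `D` modulo a definable
equivalence relation has a least support `C`, which `K` maps to itself
(`Struc.exists_invariant_support`). Let `c` list the finitely many points over `C`. Then `e` is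
defined by the formula `ψ(x, c)` which says that some copy of the points over `D` extends `c` and
that `x` is equivalent to the copy of `a`; and `ψ(x, c')` defines `e` only for the translates `c'`
of `c` under `K`, whose entries are among the finitely many points over `C`. So weak elimination
of imaginaries holds in `H`.

Since `a` ranges over finitely many possibilities up to automorphisms, all this is expressed by
first-order sentences in which a copy of the points over `D` serves as a tuple of parameters, and
these sentences hold in every model of the theory (`weakElimImaginaries_of_support`).
-/

namespace MSLanguage

variable {L : MSLanguage}

/-! ### Substitution, connectives and quantifiers -/

/-- Simultaneous substitution of terms for the variables of a term. -/
def Term.subst {α β : Type} {Γ : α → L.Sorts} {Γ' : β → L.Sorts} (τ : (i : α) → L.Term Γ' (Γ i)) :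
    {s : L.Sorts} → L.Term Γ s → L.Term Γ' s
  | _, .var i => τ i
  | _, .func f ts => .func f fun i => (ts i).subst τ

theorem Term.realize_subst (M : Struc.{u} L) {α β : Type} {Γ : α → L.Sorts} {Γ' : β → L.Sorts}
    (τ : (i : α) → L.Term Γ' (Γ i)) (v : M.Tuple Γ') {s : L.Sorts} (t : L.Term Γ s) :
    (t.subst τ).realize M v = t.realize M (fun i => (τ i).realize M v) := by
  induction t with
  | var i => rfl
  | func f ts ih => simp only [Term.subst, Term.realize, ih]

/-- Weakening of a term by one bound variable, which becomes variable `0`. -/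
def Term.lift {α : Type} {Γ : α → L.Sorts} {m : ℕ} {Δ : Fin m → L.Sorts} (s' : L.Sorts)
    {s : L.Sorts} (t : L.Term (Sum.elim Γ Δ) s) :
    L.Term (Sum.elim Γ (Fin.cons s' Δ : Fin (m + 1) → L.Sorts)) s :=
  t.subst fun i => match i with
    | Sum.inl a => .var (Γ := Sum.elim Γ (Fin.cons s' Δ : Fin (m + 1) → L.Sorts)) (Sum.inl a)
    | Sum.inr j => .var (Γ := Sum.elim Γ (Fin.cons s' Δ : Fin (m + 1) → L.Sorts)) (Sum.inr j.succ)

theorem Term.realize_lift (M : Struc.{u} L) {α : Type} {Γ : α → L.Sorts} {m : ℕ}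
    {Δ : Fin m → L.Sorts} {s' s : L.Sorts} (t : L.Term (Sum.elim Γ Δ) s)
    (v : M.Tuple Γ) (y : M.Tuple Δ) (a : M.carrier s') :
    (t.lift s').realize M (Struc.Tuple.append v (Struc.Tuple.cons a y)) =
      t.realize M (Struc.Tuple.append v y) := by
  rw [Term.lift, Term.realize_subst]
  congr 1
  funext i
  cases i <;> rfl

/-- The terms for a substitution under a quantifier: variable `0` is kept and the other variables
are replaced by the weakened terms. -/
def Term.underBinder {α β : Type} {Γ : α → L.Sorts} {Γ' : β → L.Sorts} {m m' : ℕ}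
    {Δ : Fin m → L.Sorts} {Δ' : Fin m' → L.Sorts} (s : L.Sorts)
    (τ : (i : α ⊕ Fin m) → L.Term (Sum.elim Γ' Δ') (Sum.elim Γ Δ i)) :
    (i : α ⊕ Fin (m + 1)) → L.Term (Sum.elim Γ' (Fin.cons s Δ' : Fin (m' + 1) → L.Sorts))
      (Sum.elim Γ (Fin.cons s Δ : Fin (m + 1) → L.Sorts) i)
  | Sum.inl a => (τ (Sum.inl a)).lift s
  | Sum.inr j => Fin.cases
      (motive := fun j => L.Term (Sum.elim Γ' (Fin.cons s Δ' : Fin (m' + 1) → L.Sorts))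
        ((Fin.cons s Δ : Fin (m + 1) → L.Sorts) j))
      (.var (Γ := Sum.elim Γ' (Fin.cons s Δ' : Fin (m' + 1) → L.Sorts)) (Sum.inr 0))
      (fun j => (τ (Sum.inr j)).lift s) j

theorem Term.realize_underBinder (M : Struc.{u} L) {α β : Type} {Γ : α → L.Sorts}
    {Γ' : β → L.Sorts} {m m' : ℕ} {Δ : Fin m → L.Sorts} {Δ' : Fin m' → L.Sorts} {s : L.Sorts}
    (τ : (i : α ⊕ Fin m) → L.Term (Sum.elim Γ' Δ') (Sum.elim Γ Δ i))
    (v : M.Tuple Γ') (y : M.Tuple Δ') (a : M.carrier s) :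
    (fun i => (underBinder s τ i).realize M (Struc.Tuple.append v (Struc.Tuple.cons a y))) =
      Struc.Tuple.append (M := M)
        (fun i => (τ (Sum.inl i)).realize M (Struc.Tuple.append v y))
        (Struc.Tuple.cons a
          (fun j => (τ (Sum.inr j)).realize M (Struc.Tuple.append v y) : M.Tuple Δ)) := by
  funext i
  rcases i with i | j
  · exact realize_lift M _ v y a
  · refine Fin.cases ?_ (fun j => ?_) j
    · rfl
    · exact realize_lift M _ v y a

/-- Substitution of terms for the free and the further variables of a bounded formula. -/
def BoundedFormula.subst {α β : Type} {Γ : α → L.Sorts} {Γ' : β → L.Sorts} :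
    {m m' : ℕ} → {Δ : Fin m → L.Sorts} → {Δ' : Fin m' → L.Sorts} →
    ((i : α ⊕ Fin m) → L.Term (Sum.elim Γ' Δ') (Sum.elim Γ Δ i)) →
    L.BoundedFormula Γ Δ → L.BoundedFormula Γ' Δ'
  | _, _, _, _, _, .falsum => .falsum
  | _, _, _, _, τ, .equal s t₁ t₂ => .equal s (t₁.subst τ) (t₂.subst τ)
  | _, _, _, _, τ, .rel r ts => .rel r fun i => (ts i).subst τ
  | _, _, _, _, τ, .imp φ ψ => .imp (φ.subst τ) (ψ.subst τ)
  | _, _, _, _, τ, .all s φ => .all s (φ.subst (Term.underBinder s τ))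

theorem Struc.Tuple.append_realize_eq (M : Struc.{u} L) {α β : Type} {γ : Type} {Γ : α → L.Sorts}
    {Δ : γ → L.Sorts} {Γ' : β → L.Sorts} (τ : (i : α ⊕ γ) → L.Term Γ' (Sum.elim Γ Δ i))
    (w : M.Tuple Γ') :
    (fun i => (τ i).realize M w) =
      Struc.Tuple.append (M := M) (fun i => (τ (Sum.inl i)).realize M w : M.Tuple Γ)
        (fun i => (τ (Sum.inr i)).realize M w : M.Tuple Δ) := by
  funext i
  cases i <;> rfl

theorem BoundedFormula.realize_subst (M : Struc.{u} L) {α β : Type} {Γ : α → L.Sorts}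
    {Γ' : β → L.Sorts} {m : ℕ} {Δ : Fin m → L.Sorts} (φ : L.BoundedFormula Γ Δ) :
    ∀ {m' : ℕ} {Δ' : Fin m' → L.Sorts}
      (τ : (i : α ⊕ Fin m) → L.Term (Sum.elim Γ' Δ') (Sum.elim Γ Δ i))
      (v : M.Tuple Γ') (y : M.Tuple Δ'),
      (φ.subst τ).Realize M v y ↔
        φ.Realize M (fun i => (τ (Sum.inl i)).realize M (Struc.Tuple.append v y))
          (fun j => (τ (Sum.inr j)).realize M (Struc.Tuple.append v y)) := by
  induction φ with
  | falsum => intros; rfl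
  | equal s t₁ t₂ =>
    intro m' Δ' τ v y
    simp only [subst, Realize, Term.realize_subst, Struc.Tuple.append_realize_eq]
    exact Iff.rfl
  | rel r ts =>
    intro m' Δ' τ v y
    simp only [subst, Realize, Term.realize_subst, Struc.Tuple.append_realize_eq]
    exact Iff.rfl
  | imp φ ψ ihφ ihψ =>
    intro m' Δ' τ v y
    simp only [subst, Realize, ihφ, ihψ]
  | all s φ ih =>
    intro m' Δ' τ v y
    simp only [subst, Realize, ih]
    refine forall_congr' fun a => ?_
    have h := Term.realize_underBinder M τ v y a
    rw [Struc.Tuple.append_realize_eq] at h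
    have h1 := fun i => congrFun h (Sum.inl i)
    have h2 := fun i => congrFun h (Sum.inr i)
    simp only [Struc.Tuple.append] at h1 h2
    rw [funext h1, funext h2]
    exact Iff.rfl

theorem BoundedFormula.realize_subst_iff (M : Struc.{u} L) {α β : Type} {Γ : α → L.Sorts}
    {Γ' : β → L.Sorts} {m m' : ℕ} {Δ : Fin m → L.Sorts} {Δ' : Fin m' → L.Sorts}
    (φ : L.BoundedFormula Γ Δ) (τ : (i : α ⊕ Fin m) → L.Term (Sum.elim Γ' Δ') (Sum.elim Γ Δ i))
    (v : M.Tuple Γ') (y : M.Tuple Δ') (v' : M.Tuple Γ) (y' : M.Tuple Δ)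
    (hv : ∀ i, (τ (Sum.inl i)).realize M (Struc.Tuple.append v y) = v' i)
    (hy : ∀ j, (τ (Sum.inr j)).realize M (Struc.Tuple.append v y) = y' j) :
    (φ.subst τ).Realize M v y ↔ φ.Realize M v' y' := by
  rw [realize_subst, ← funext hv, ← funext hy]
  exact Iff.rfl

namespace Formula

variable {α β : Type} {Γ : α → L.Sorts} {Δ : β → L.Sorts}

/-- Substitution of terms for the free variables of a formula. -/
def subst (τ : (i : α) → L.Term Δ (Γ i)) (φ : L.Formula Γ) : L.Formula Δ :=
  BoundedFormula.subst (fun i => match i with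
    | Sum.inl i => (τ i).subst fun j =>
        .var (Γ := Sum.elim Δ (Fin.elim0 : Fin 0 → L.Sorts)) (Sum.inl j)
    | Sum.inr j => j.elim0) φ

theorem holds_subst (M : Struc.{u} L) (τ : (i : α) → L.Term Δ (Γ i)) (φ : L.Formula Γ)
    (v : M.Tuple Δ) :
    (φ.subst τ).Holds M v ↔ φ.Holds M (fun i => (τ i).realize M v) :=
  BoundedFormula.realize_subst_iff M φ _ _ _ _ _ (fun _ => Term.realize_subst M _ _ _)
    fun j => j.elim0

/-- Equality of two terms. -/
def eq {s : L.Sorts} (t₁ t₂ : L.Term Γ s) : L.Formula Γ :=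
  .equal s (t₁.subst fun j => .var (Γ := Sum.elim Γ (Fin.elim0 : Fin 0 → L.Sorts)) (Sum.inl j))
    (t₂.subst fun j => .var (Γ := Sum.elim Γ (Fin.elim0 : Fin 0 → L.Sorts)) (Sum.inl j))

theorem holds_eq (M : Struc.{u} L) {s : L.Sorts} (t₁ t₂ : L.Term Γ s) (v : M.Tuple Γ) :
    (eq t₁ t₂).Holds M v ↔ t₁.realize M v = t₂.realize M v := by
  exact iff_of_eq (congrArg₂ Eq (Term.realize_subst M _ _ t₁) (Term.realize_subst M _ _ t₂))

/-- An atomic formula. -/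
def rel (r : L.Rel) (ts : (i : Fin (L.relArity r)) → L.Term Γ (L.relDom r i)) : L.Formula Γ :=
  BoundedFormula.rel r fun i =>
    (ts i).subst fun j => .var (Γ := Sum.elim Γ (Fin.elim0 : Fin 0 → L.Sorts)) (Sum.inl j)

theorem holds_rel (M : Struc.{u} L) (r : L.Rel)
    (ts : (i : Fin (L.relArity r)) → L.Term Γ (L.relDom r i)) (v : M.Tuple Γ) :
    (rel r ts).Holds M v ↔ M.relMap r fun i => (ts i).realize M v := by
  exact iff_of_eq (congrArg (M.relMap r) (funext fun i => Term.realize_subst M _ _ (ts i)))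

/-- Implication. -/
def imp (φ ψ : L.Formula Γ) : L.Formula Γ :=
  BoundedFormula.imp φ ψ

theorem holds_imp (M : Struc.{u} L) (φ ψ : L.Formula Γ) (v : M.Tuple Γ) :
    (φ.imp ψ).Holds M v ↔ (φ.Holds M v → ψ.Holds M v) :=
  Iff.rfl

/-- Negation. -/
def not (φ : L.Formula Γ) : L.Formula Γ :=
  φ.imp .falsum

theorem holds_not (M : Struc.{u} L) (φ : L.Formula Γ) (v : M.Tuple Γ) :
    φ.not.Holds M v ↔ ¬ φ.Holds M v :=
  Iff.rfl

/-- Conjunction. -/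
def and (φ ψ : L.Formula Γ) : L.Formula Γ :=
  (φ.imp ψ.not).not

theorem holds_and (M : Struc.{u} L) (φ ψ : L.Formula Γ) (v : M.Tuple Γ) :
    (φ.and ψ).Holds M v ↔ φ.Holds M v ∧ ψ.Holds M v := by
  simp only [and, holds_not, holds_imp]
  tauto

/-- Equivalence. -/
def iff (φ ψ : L.Formula Γ) : L.Formula Γ :=
  (φ.imp ψ).and (ψ.imp φ)

theorem holds_iff (M : Struc.{u} L) (φ ψ : L.Formula Γ) (v : M.Tuple Γ) :
    (φ.iff ψ).Holds M v ↔ (φ.Holds M v ↔ ψ.Holds M v) := by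
  simp only [iff, holds_and, holds_imp]
  tauto

/-- The conjunction of a finite family of formulas. -/
noncomputable def iAnd {ι : Type} [Finite ι] (φ : ι → L.Formula Γ) : L.Formula Γ :=
  ((@Finset.univ ι (Fintype.ofFinite ι)).toList.map φ).foldr and (not .falsum)

theorem holds_iAnd (M : Struc.{u} L) {ι : Type} [Finite ι] (φ : ι → L.Formula Γ)
    (v : M.Tuple Γ) : (iAnd φ).Holds M v ↔ ∀ i, (φ i).Holds M v := by
  have key : ∀ l : List (L.Formula Γ),
      (l.foldr and (not .falsum)).Holds M v ↔ ∀ χ ∈ l, χ.Holds M v := by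
    intro l
    induction l with
    | nil => exact iff_of_true (fun h => h) (by simp)
    | cons χ l ih => simp [holds_and, ih]
  rw [iAnd, key]
  simp

/-- The disjunction of a finite family of formulas. -/
noncomputable def iOr {ι : Type} [Finite ι] (φ : ι → L.Formula Γ) : L.Formula Γ :=
  (iAnd fun i => (φ i).not).not

theorem holds_iOr (M : Struc.{u} L) {ι : Type} [Finite ι] (φ : ι → L.Formula Γ)
    (v : M.Tuple Γ) : (iOr φ).Holds M v ↔ ∃ i, (φ i).Holds M v := by
  simp [iOr, holds_not, holds_iAnd]

end Formula

/-- The variables of a bounded formula with at least one further variable, when the sorts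
`Δ : Fin (m + 1) → L.Sorts` of the further variables are written as `Fin.cons (Δ 0) (Fin.tail Δ)`,
which is equal to `Δ` only propositionally. -/
def Term.consTailVar {α : Type} {Γ : α → L.Sorts} {m : ℕ} {Δ : Fin (m + 1) → L.Sorts} :
    (i : α ⊕ Fin (m + 1)) → L.Term
      (Sum.elim Γ (Fin.cons (Δ 0) (Fin.tail Δ) : Fin (m + 1) → L.Sorts)) (Sum.elim Γ Δ i)
  | Sum.inl a => .var (Γ := Sum.elim Γ (Fin.cons (Δ 0) (Fin.tail Δ) : Fin (m + 1) → L.Sorts))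
      (Sum.inl a)
  | Sum.inr j => Fin.cases
      (motive := fun j => L.Term
        (Sum.elim Γ (Fin.cons (Δ 0) (Fin.tail Δ) : Fin (m + 1) → L.Sorts)) (Δ j))
      (.var (Γ := Sum.elim Γ (Fin.cons (Δ 0) (Fin.tail Δ) : Fin (m + 1) → L.Sorts)) (Sum.inr 0))
      (fun j => .var (Γ := Sum.elim Γ (Fin.cons (Δ 0) (Fin.tail Δ) : Fin (m + 1) → L.Sorts))
        (Sum.inr j.succ)) j

/-- Universal quantification over all the further variables of a bounded formula. -/
def BoundedFormula.alls {α : Type} {Γ : α → L.Sorts} :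
    {m : ℕ} → {Δ : Fin m → L.Sorts} → L.BoundedFormula Γ Δ → L.Formula Γ
  | 0, Δ, φ => φ.subst (Γ := Γ) (Δ := Δ) fun i => match i with
      | Sum.inl a => .var (Γ := Sum.elim Γ (Fin.elim0 : Fin 0 → L.Sorts)) (Sum.inl a)
      | Sum.inr j => j.elim0
  | _ + 1, Δ, φ => alls (.all (Δ 0) (φ.subst Term.consTailVar))

theorem BoundedFormula.holds_alls (M : Struc.{u} L) {α : Type} {Γ : α → L.Sorts} (v : M.Tuple Γ) :
    ∀ {m : ℕ} {Δ : Fin m → L.Sorts} (φ : L.BoundedFormula Γ Δ),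
      φ.alls.Holds M v ↔ ∀ y : M.Tuple Δ, φ.Realize M v y
  | 0, Δ, φ => by
    have h : ∀ y : M.Tuple Δ, φ.alls.Holds M v ↔ φ.Realize M v y := fun y =>
      realize_subst_iff M φ _ _ _ _ _ (fun _ => rfl) fun j => j.elim0
    exact ⟨fun h' y => (h y).1 h', fun h' => (h fun j => j.elim0).2 (h' _)⟩
  | m + 1, Δ, φ => by
    rw [alls, holds_alls M v]
    have h : ∀ y : M.Tuple Δ, (φ.subst Term.consTailVar).Realize M v
        (Struc.Tuple.cons (y 0) fun j => y j.succ : M.Tuple (Fin.cons (Δ 0) (Fin.tail Δ))) ↔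
          φ.Realize M v y := fun y =>
      realize_subst_iff M φ _ _ _ v y (fun _ => rfl) fun j => Fin.cases rfl (fun _ => rfl) j
    constructor
    · exact fun h' y => (h y).1 (h' (fun j => y j.succ) (y 0))
    · intro h' y a
      exact (h (Fin.cases (motive := fun j => M.carrier (Δ j)) a y)).2 (h' _)

/-- The variable `b`, in the variables reindexed along `e`. -/
def Term.reindexVar {β : Type} {k : ℕ} {Δ : β → L.Sorts} (e : Fin k ≃ β) (b : β) :
    L.Term (Δ ∘ e) (Δ b) :=
  Equiv.piCongrLeft (fun b => L.Term (Δ ∘ e) (Δ b)) e (fun j => .var (Γ := Δ ∘ e) j) b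

theorem Term.realize_reindexVar (M : Struc.{u} L) {β : Type} {k : ℕ} {Δ : β → L.Sorts}
    (e : Fin k ≃ β) (x : M.Tuple Δ) (b : β) :
    (reindexVar e b : L.Term (Δ ∘ e) (Δ b)).realize M (fun j => x (e j)) = x b := by
  obtain ⟨j, rfl⟩ := e.surjective b
  rw [reindexVar, Equiv.piCongrLeft_apply_apply]
  rfl

theorem Struc.Tuple.exists_reindex (M : Struc.{u} L) {β : Type} {k : ℕ} {Δ : β → L.Sorts}
    (e : Fin k ≃ β) (y : M.Tuple (Δ ∘ e)) : ∃ x : M.Tuple Δ, y = fun j => x (e j) := by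
  refine ⟨Equiv.piCongrLeft (fun b => M.carrier (Δ b)) e y, ?_⟩
  funext j
  exact (Equiv.piCongrLeft_apply_apply (fun b => M.carrier (Δ b)) e y j).symm

namespace Formula

variable {α β : Type} {Γ : α → L.Sorts} {Δ : β → L.Sorts}

/-- Universal quantification over a finite tuple of free variables. -/
noncomputable def allTuple [Finite β] (φ : L.Formula (Sum.elim Γ Δ)) : L.Formula Γ :=
  BoundedFormula.alls (Δ := Δ ∘ (Finite.equivFin β).symm) <|
    BoundedFormula.subst (Γ := Sum.elim Γ Δ) (Δ := Fin.elim0) (fun i => match i with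
      | Sum.inl (Sum.inl a) => .var (Γ := Sum.elim Γ (Δ ∘ (Finite.equivFin β).symm)) (Sum.inl a)
      | Sum.inl (Sum.inr b) => (Term.reindexVar (Finite.equivFin β).symm b).subst fun j =>
          .var (Γ := Sum.elim Γ (Δ ∘ (Finite.equivFin β).symm)) (Sum.inr j)
      | Sum.inr j => j.elim0) φ

theorem holds_allTuple [Finite β] (M : Struc.{u} L) (φ : L.Formula (Sum.elim Γ Δ))
    (v : M.Tuple Γ) :
    φ.allTuple.Holds M v ↔ ∀ y : M.Tuple Δ, φ.Holds M (Struc.Tuple.append v y) := by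
  have key : ∀ x : M.Tuple Δ, BoundedFormula.Realize M v _
      (fun j => x ((Finite.equivFin β).symm j)) ↔ φ.Holds M (Struc.Tuple.append v x) := fun x =>
    BoundedFormula.realize_subst_iff M (Γ := Sum.elim Γ Δ) (Δ := Fin.elim0) (Γ' := Γ)
      (Δ' := Δ ∘ (Finite.equivFin β).symm) φ
      (fun i => match i with
      | Sum.inl (Sum.inl a) => .var (Γ := Sum.elim Γ (Δ ∘ (Finite.equivFin β).symm)) (Sum.inl a)
      | Sum.inl (Sum.inr b) => (Term.reindexVar (Finite.equivFin β).symm b).subst fun j =>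
          .var (Γ := Sum.elim Γ (Δ ∘ (Finite.equivFin β).symm)) (Sum.inr j)
      | Sum.inr j => j.elim0) v _ (Struc.Tuple.append v x) (fun j => j.elim0)
      (fun i => match i with
        | Sum.inl _ => rfl
        | Sum.inr b => (Term.realize_subst M _ _ _).trans (Term.realize_reindexVar M _ x b))
      fun j => j.elim0
  rw [allTuple, BoundedFormula.holds_alls]
  constructor
  · exact fun h x => (key x).1 (h fun j => x _)
  · intro h y
    obtain ⟨x, rfl⟩ := Struc.Tuple.exists_reindex M _ y
    exact (key x).2 (h x)

/-- Existential quantification over a finite tuple of free variables. -/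
noncomputable def exTuple [Finite β] (φ : L.Formula (Sum.elim Γ Δ)) : L.Formula Γ :=
  φ.not.allTuple.not

theorem holds_exTuple [Finite β] (M : Struc.{u} L) (φ : L.Formula (Sum.elim Γ Δ))
    (v : M.Tuple Γ) :
    φ.exTuple.Holds M v ↔ ∃ y : M.Tuple Δ, φ.Holds M (Struc.Tuple.append v y) := by
  simp [exTuple, holds_not, holds_allTuple]

end Formula
end MSLanguage

namespace MSLanguage

variable {L : MSLanguage}

namespace Formula

variable {α β γ : Type} {Γ : α → L.Sorts} {Δ : β → L.Sorts} {Θ : γ → L.Sorts}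

/-- Substitution of terms in a formula whose variables come in two groups. -/
def subst₂ (τ₁ : (i : α) → L.Term Θ (Γ i)) (τ₂ : (j : β) → L.Term Θ (Δ j))
    (φ : L.Formula (Sum.elim Γ Δ)) : L.Formula Θ :=
  φ.subst fun i => match i with
    | Sum.inl i => τ₁ i
    | Sum.inr j => τ₂ j

theorem holds_subst₂ (M : Struc.{u} L) (τ₁ : (i : α) → L.Term Θ (Γ i))
    (τ₂ : (j : β) → L.Term Θ (Δ j)) (φ : L.Formula (Sum.elim Γ Δ)) (v : M.Tuple Θ) :
    (φ.subst₂ τ₁ τ₂).Holds M v ↔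
      φ.Holds M (Struc.Tuple.append (fun i => (τ₁ i).realize M v : M.Tuple Γ)
        (fun j => (τ₂ j).realize M v : M.Tuple Δ)) := by
  rw [subst₂, holds_subst, Struc.Tuple.append_realize_eq]
  exact Iff.rfl

end Formula

/-- The variable `i` of the first of two groups of variables. -/
abbrev Term.fst {α β : Type} {Γ : α → L.Sorts} {Δ : β → L.Sorts} (i : α) :
    L.Term (Sum.elim Γ Δ) (Γ i) :=
  .var (Γ := Sum.elim Γ Δ) (Sum.inl i)

/-- The variable `j` of the second of two groups of variables. -/
abbrev Term.snd {α β : Type} {Γ : α → L.Sorts} {Δ : β → L.Sorts} (j : β) :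
    L.Term (Sum.elim Γ Δ) (Δ j) :=
  .var (Γ := Sum.elim Γ Δ) (Sum.inr j)

theorem Term.realize_fst (M : Struc.{u} L) {α β : Type} {Γ : α → L.Sorts} {Δ : β → L.Sorts}
    (i : α) (x : M.Tuple Γ) (y : M.Tuple Δ) :
    (Term.fst i : L.Term (Sum.elim Γ Δ) (Γ i)).realize M (Struc.Tuple.append x y) = x i :=
  rfl

theorem Term.realize_snd (M : Struc.{u} L) {α β : Type} {Γ : α → L.Sorts} {Δ : β → L.Sorts}
    (j : β) (x : M.Tuple Γ) (y : M.Tuple Δ) :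
    (Term.snd j : L.Term (Sum.elim Γ Δ) (Δ j)).realize M (Struc.Tuple.append x y) = y j :=
  rfl

/-! ### Models of a complete theory -/

theorem Struc.IsModel.satisfies_iff {H : Struc.{0} L} {M : Struc.{u} L}
    (hM : M.IsModel H.completeTheory) (φ : L.Sentence) : M.Satisfies φ ↔ H.Satisfies φ := by
  refine ⟨fun h => ?_, hM φ⟩
  by_contra hφ
  exact hM φ.not hφ h

theorem Struc.IsModel.forall_holds_iff {H : Struc.{0} L} {M : Struc.{u} L}
    (hM : M.IsModel H.completeTheory) {α : Type} [Finite α] {Γ : α → L.Sorts} (φ : L.Formula Γ) :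
    (∀ v, φ.Holds M v) ↔ ∀ v, φ.Holds H v := by
  have h := hM.satisfies_iff
    (Formula.allTuple (Γ := (Empty.elim : Empty → L.Sorts)) (φ.subst fun i => Term.snd i))
  unfold Satisfies at h
  simp only [Formula.holds_allTuple, Formula.holds_subst, Term.realize_snd] at h
  exact h

/-! ### Automorphisms -/

/-- The group of automorphisms of `M`, as a group of families of permutations of the sorts. -/
def Struc.autGroup (M : Struc.{u} L) : Subgroup ((s : L.Sorts) → Equiv.Perm (M.carrier s)) where
  carrier := {γ | (∀ f x, γ _ (M.funMap f x) = M.funMap f fun i => γ _ (x i)) ∧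
    ∀ r x, (M.relMap r fun i => γ _ (x i)) ↔ M.relMap r x}
  one_mem' := ⟨fun _ _ => rfl, fun _ _ => Iff.rfl⟩
  mul_mem' := by
    rintro γ δ ⟨hγ, hγ'⟩ ⟨hδ, hδ'⟩
    refine ⟨fun f x => ?_, fun r x => ?_⟩
    · simp only [Pi.mul_apply, Equiv.Perm.mul_apply, hγ, hδ]
    · simp only [Pi.mul_apply, Equiv.Perm.mul_apply, hγ', hδ']
  inv_mem' := by
    rintro γ ⟨hγ, hγ'⟩
    refine ⟨fun f x => ?_, fun r x => ?_⟩
    · rw [Pi.inv_apply, Equiv.Perm.inv_eq_iff_eq, hγ]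
      simp
    · rw [← hγ']
      simp

theorem Struc.autGroup_realize {M : Struc.{u} L} {γ : (s : L.Sorts) → Equiv.Perm (M.carrier s)}
    (hγ : γ ∈ M.autGroup) {α : Type} {Γ : α → L.Sorts} (v : M.Tuple Γ) {s : L.Sorts}
    (t : L.Term Γ s) : t.realize M (fun i => γ _ (v i)) = γ s (t.realize M v) := by
  induction t with
  | var i => rfl
  | func f ts ih => simp only [Term.realize, ih, hγ.1]

theorem Struc.Tuple.append_map {M : Struc.{u} L} (γ : (s : L.Sorts) → Equiv.Perm (M.carrier s))
    {α β : Type} {Γ : α → L.Sorts} {Δ : β → L.Sorts} (x : M.Tuple Γ) (y : M.Tuple Δ) :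
    Struc.Tuple.append (M := M) (fun i => γ _ (x i) : M.Tuple Γ) (fun j => γ _ (y j) : M.Tuple Δ) =
      fun i => γ _ (Struc.Tuple.append x y i) := by
  funext i
  cases i <;> rfl

theorem Struc.autGroup_boundedFormula_realize {M : Struc.{u} L}
    {γ : (s : L.Sorts) → Equiv.Perm (M.carrier s)}
    (hγ : γ ∈ M.autGroup) {α : Type} {Γ : α → L.Sorts} (v : M.Tuple Γ) {m : ℕ}
    {Δ : Fin m → L.Sorts} (φ : L.BoundedFormula Γ Δ) : ∀ y : M.Tuple Δ,
    (φ.Realize M (fun i => γ _ (v i)) fun j => γ _ (y j)) ↔ φ.Realize M v y := by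
  induction φ with
  | falsum => exact fun _ => Iff.rfl
  | equal s t₁ t₂ =>
    intro y
    simp only [BoundedFormula.Realize, Struc.Tuple.append_map, autGroup_realize hγ,
      EmbeddingLike.apply_eq_iff_eq]
  | rel r ts =>
    intro y
    simp only [BoundedFormula.Realize, Struc.Tuple.append_map, autGroup_realize hγ, hγ.2]
  | imp φ ψ ihφ ihψ =>
    intro y
    simp only [BoundedFormula.Realize, ihφ, ihψ]
  | @all m Δ s φ ih =>
    intro y
    simp only [BoundedFormula.Realize]
    rw [← (γ s).forall_congr_right]
    refine forall_congr' fun a => ?_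
    rw [← ih]
    have : (Struc.Tuple.cons (γ s a) fun j => γ _ (y j) : M.Tuple (Fin.cons s Δ : Fin (m + 1) → _))
        = fun j => γ _ (Struc.Tuple.cons a y j) := by
      funext j
      refine Fin.cases ?_ (fun j => ?_) j <;> rfl
    rw [this]

theorem Struc.autGroup_holds {M : Struc.{u} L} {γ : (s : L.Sorts) → Equiv.Perm (M.carrier s)}
    (hγ : γ ∈ M.autGroup) {α : Type} {Γ : α → L.Sorts} (v : M.Tuple Γ) (φ : L.Formula Γ) :
    φ.Holds M (fun i => γ _ (v i)) ↔ φ.Holds M v := by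
  unfold Formula.Holds
  rw [← autGroup_boundedFormula_realize hγ v φ]
  have : (fun j : Fin 0 => γ _ (j.elim0 : M.carrier ((Fin.elim0 : Fin 0 → L.Sorts) j))) =
    fun j => j.elim0 := funext fun j => j.elim0
  rw [this]

theorem Struc.autGroup_holds_append {M : Struc.{u} L}
    {γ : (s : L.Sorts) → Equiv.Perm (M.carrier s)} (hγ : γ ∈ M.autGroup) {α β : Type}
    {Γ : α → L.Sorts} {Δ : β → L.Sorts} (φ : L.Formula (Sum.elim Γ Δ))
    (x : M.Tuple Γ) (y : M.Tuple Δ) :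
    φ.Holds M (Struc.Tuple.append (fun i => γ _ (x i) : M.Tuple Γ)
      (fun j => γ _ (y j) : M.Tuple Δ)) ↔ φ.Holds M (Struc.Tuple.append x y) := by
  rw [Struc.Tuple.append_map]
  exact autGroup_holds hγ _ φ

/-! ### Weak elimination of imaginaries from supports -/

/-- The formula `ψ(x, z)`: for some tuple `F` that satisfies `φ`, the part of `F` listed by `ι` is
`z`, and `x` is `E`-equivalent to the part of `F` listed by `at'`. -/
noncomputable def Formula.classOfPart {α β β' : Type} [Finite β] [Finite β'] {Ξ : β → L.Sorts}
    (φ : L.Formula Ξ) (ι : β' → β) (at' : α → β)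
    (E : L.Formula (Sum.elim (fun i => Ξ (at' i)) fun i => Ξ (at' i))) :
    L.Formula (Sum.elim (fun i => Ξ (at' i)) fun j => Ξ (ι j)) :=
  exTuple (Δ := Ξ) ((φ.subst Term.snd).and
    ((iAnd fun j => eq (Term.fst (Γ := Sum.elim (fun i => Ξ (at' i)) fun j => Ξ (ι j))
      (Sum.inr j)) (Term.snd (ι j))).and
    (E.subst₂ (fun i => Term.fst (Γ := Sum.elim (fun i => Ξ (at' i)) fun j => Ξ (ι j))
      (Sum.inl i)) fun i => Term.snd (at' i))))

theorem Formula.holds_classOfPart (M : Struc.{u} L) {α β β' : Type} [Finite β] [Finite β']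
    {Ξ : β → L.Sorts} (φ : L.Formula Ξ) (ι : β' → β) (at' : α → β)
    (E : L.Formula (Sum.elim (fun i => Ξ (at' i)) fun i => Ξ (at' i)))
    (x : M.Tuple fun i => Ξ (at' i)) (z : M.Tuple fun j => Ξ (ι j)) :
    (classOfPart φ ι at' E).Holds M (Struc.Tuple.append x z) ↔
      ∃ F : M.Tuple Ξ, φ.Holds M F ∧ (∀ j, z j = F (ι j)) ∧
        E.Holds M (Struc.Tuple.append x fun i => F (at' i)) := by
  simp only [classOfPart, holds_exTuple, holds_and, holds_subst, holds_iAnd]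
  exact exists_congr fun F => and_congr Iff.rfl
    (and_congr (forall_congr' fun j => holds_eq M _ _ _) (holds_subst₂ M _ _ E _))

section Support

variable (H : Struc.{0} L) (supp : (s : L.Sorts) → H.carrier s → Finset ℕ)

/-- The points of `H`, of all sorts, whose support is contained in `D`. -/
abbrev Struc.PointsOver (D : Finset ℕ) : Type :=
  Σ s, {x : H.carrier s // supp s x ⊆ D}

/-- The group of automorphisms of `H` that fix every point whose support is contained in `D`. -/
def Struc.fixing (D : Finset ℕ) : Subgroup ((s : L.Sorts) → Equiv.Perm (H.carrier s)) where
  carrier := {γ | γ ∈ H.autGroup ∧ ∀ s x, supp s x ⊆ D → γ s x = x}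
  one_mem' := ⟨one_mem _, fun _ _ _ => rfl⟩
  mul_mem' := by
    rintro γ δ ⟨hγ, hγ'⟩ ⟨hδ, hδ'⟩
    refine ⟨mul_mem hγ hδ, fun s x hx => ?_⟩
    rw [Pi.mul_apply, Equiv.Perm.mul_apply, hδ' s x hx, hγ' s x hx]
  inv_mem' := by
    rintro γ ⟨hγ, hγ'⟩
    refine ⟨inv_mem hγ, fun s x hx => ?_⟩
    rw [Pi.inv_apply, Equiv.Perm.inv_eq_iff_eq, hγ' s x hx]

variable {H supp}

/-- If two supports of a group `K` of automorphisms intersect in a support, then a support `C` of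
least cardinality is mapped to itself by all of `K`, because it has to equal its intersection with
each of its translates, which are supports of `K` as well. -/
theorem Struc.exists_invariant_support
    (hact : ∀ γ ∈ H.autGroup, ∃ σ : Equiv.Perm ℕ, ∀ s x,
      supp s (γ s x) = (supp s x).map σ.toEmbedding)
    (hint : ∀ A B, H.fixing supp (A ∩ B) ≤ H.fixing supp A ⊔ H.fixing supp B)
    {K : Subgroup ((s : L.Sorts) → Equiv.Perm (H.carrier s))} (hK : K ≤ H.autGroup)
    {D : Finset ℕ} (hD : H.fixing supp D ≤ K) :
    ∃ C ⊆ D, H.fixing supp C ≤ K ∧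
      ∀ γ ∈ K, ∀ s x, supp s x ⊆ C → supp s (γ s x) ⊆ C := by
  obtain ⟨C, hC, hmin⟩ :=
    (measure Finset.card).wf.has_min {C : Finset ℕ | H.fixing supp C ≤ K} ⟨D, hD⟩
  have key : ∀ B, H.fixing supp B ≤ K → C ⊆ B := by
    intro B hB
    have h1 : H.fixing supp (C ∩ B) ≤ K := (hint C B).trans (sup_le hC hB)
    have h2 : C.card ≤ (C ∩ B).card := not_lt.1 (hmin _ h1)
    exact Finset.inter_eq_left.1 (Finset.eq_of_subset_of_card_le Finset.inter_subset_left h2)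
  refine ⟨C, key D hD, hC, fun γ hγ s x hx => ?_⟩
  obtain ⟨σ, hσ⟩ := hact γ (hK hγ)
  have hσC : C ⊆ C.map σ.toEmbedding := by
    refine key _ fun δ hδ => ?_
    have h : γ⁻¹ * δ * γ ∈ K := by
      refine hC ⟨mul_mem (mul_mem (inv_mem (hK hγ)) hδ.1) (hK hγ), fun s x hx => ?_⟩
      have : δ s (γ s x) = γ s x :=
        hδ.2 s _ (by rw [hσ]; exact Finset.map_subset_map.2 hx)
      simp [this]
    have h' := mul_mem (mul_mem hγ h) (inv_mem hγ)
    simpa [mul_assoc] using h'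
  have hCσ : C = C.map σ.toEmbedding :=
    Finset.eq_of_subset_of_card_le hσC (by simp)
  rw [hσ, hCσ]
  exact Finset.map_subset_map.2 hx

/-- The equivalence relation defined by `E` remains one in a structure with the same theory. -/
theorem Struc.IsModel.equivalence {M : Struc.{u} L} (hM : M.IsModel H.completeTheory)
    {α : Type} [Finite α] {Γ : α → L.Sorts} (E : L.Formula (Sum.elim Γ Γ))
    (hE : Equivalence fun x y : M.Tuple Γ => E.Holds M (Struc.Tuple.append x y)) :
    Equivalence fun x y : H.Tuple Γ => E.Holds H (Struc.Tuple.append x y) := by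
  refine ⟨?_, ?_, ?_⟩
  · have := (hM.forall_holds_iff (E.subst₂ (fun i => .var i) fun i => .var i)).1
    simp only [Formula.holds_subst₂, Term.realize] at this
    exact this hE.refl
  · have := (hM.forall_holds_iff (E.imp (E.subst₂ Term.snd Term.fst))).1
    simp only [Formula.holds_subst₂, Formula.holds_imp] at this
    intro x y
    refine this (fun v h => ?_) (Struc.Tuple.append x y)
    refine hE.symm (x := fun i => v (Sum.inl i)) (y := fun i => v (Sum.inr i)) ?_
    convert h using 1
    funext i
    cases i <;> rfl
  · have := (hM.forall_holds_iff (Γ := Sum.elim (Sum.elim Γ Γ) Γ)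
      ((E.subst₂ (fun i => Term.fst (Sum.inl i)) (fun i => Term.fst (Sum.inr i))).imp
        ((E.subst₂ (fun i => Term.fst (Sum.inr i)) Term.snd).imp
          (E.subst₂ (fun i => Term.fst (Sum.inl i)) Term.snd)))).1
    intro x y z hxy hyz
    refine (Formula.holds_subst₂ H _ _ E _).1 (this (fun v h₁ h₂ => ?_)
      (Struc.Tuple.append (Struc.Tuple.append x y) z)
      ((Formula.holds_subst₂ H _ _ E _).2 hxy) ((Formula.holds_subst₂ H _ _ E _).2 hyz))
    exact (Formula.holds_subst₂ M _ _ E v).2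
      (hE.trans ((Formula.holds_subst₂ M _ _ E v).1 h₁) ((Formula.holds_subst₂ M _ _ E v).1 h₂))

/-- The automorphisms of `H` that fix the class of `a` modulo an equivalence relation definable
without parameters. -/
def Struc.classStabilizer {α : Type} {Γ : α → L.Sorts} (E : L.Formula (Sum.elim Γ Γ))
    (hE : Equivalence fun x y : H.Tuple Γ => E.Holds H (Struc.Tuple.append x y)) (a : H.Tuple Γ) :
    Subgroup ((s : L.Sorts) → Equiv.Perm (H.carrier s)) where
  carrier := {γ | γ ∈ H.autGroup ∧
    E.Holds H (Struc.Tuple.append (fun i => γ _ (a i) : H.Tuple Γ) a)}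
  one_mem' := ⟨one_mem _, hE.refl a⟩
  mul_mem' := by
    rintro γ δ ⟨hγ, hγ'⟩ ⟨hδ, hδ'⟩
    exact ⟨mul_mem hγ hδ, hE.trans ((autGroup_holds_append hγ E _ _).2 hδ') hγ'⟩
  inv_mem' := by
    rintro γ ⟨hγ, hγ'⟩
    refine ⟨inv_mem hγ, hE.symm ?_⟩
    rw [← autGroup_holds_append hγ]
    simpa using hγ'

/-- A criterion for weak elimination of imaginaries. Every point of `H` has a finite support, with
finitely many points over a finite set, such that the copies of the points over `D` under
automorphisms are defined by a formula, tuples can be moved over a fixed finite set, and the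
automorphisms fixing all points over `A ∩ B` are generated by those fixing all points over `A` and
those fixing all points over `B`. Then an imaginary, the class of a tuple `a` over `D`, is
interdefinable with the finite set of translates, under its stabilizer, of a tuple that lists the
points over its least support. -/
theorem weakElimImaginaries_of_support
    (hfin : ∀ D, Finite (H.PointsOver supp D))
    (hcopy : ∀ D, ∃ φ : L.Formula (fun p : H.PointsOver supp D => p.1), ∀ F,
      φ.Holds H F ↔ ∃ γ ∈ H.autGroup, ∀ p, F p = γ p.1 p.2.1)
    (hcov : ∀ (k : ℕ) (Γ : Fin k → L.Sorts), ∃ D, ∀ a : H.Tuple Γ, ∃ γ ∈ H.autGroup,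
      ∀ i, supp _ (γ _ (a i)) ⊆ D)
    (hact : ∀ γ ∈ H.autGroup, ∃ σ : Equiv.Perm ℕ, ∀ s x,
      supp s (γ s x) = (supp s x).map σ.toEmbedding)
    (hint : ∀ A B, H.fixing supp (A ∩ B) ≤ H.fixing supp A ⊔ H.fixing supp B) :
    Theory.WeakElimImaginaries.{u} H.completeTheory := by
  intro M hM k Γ E hEM a
  have hEH := hM.equivalence E hEM
  have hfin' : ∀ D s, Finite {x : H.carrier s // supp s x ⊆ D} := fun D s =>
    have := hfin D
    Finite.of_injective (fun x => (⟨s, x⟩ : H.PointsOver supp D))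
      fun x y h => eq_of_heq (Sigma.mk.inj h).2
  obtain ⟨D, hD⟩ := hcov k Γ
  obtain ⟨fr, hfr⟩ := hcopy D
  have := hfin D
  -- Every tuple of `M` is read off from a copy of the points over `D`.
  obtain ⟨F, hF, t, ht⟩ : ∃ F : M.Tuple fun p : H.PointsOver supp D => p.1, fr.Holds M F ∧
      ∃ t : (i : Fin k) → {x : H.carrier (Γ i) // supp _ x ⊆ D}, ∀ i, a i = F ⟨Γ i, t i⟩ := by
    have h := (hM.forall_holds_iff (Γ := Γ) (Formula.exTuple
      (Δ := fun p : H.PointsOver supp D => p.1)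
      ((fr.subst Term.snd).and (Formula.iOr
        fun t : (i : Fin k) → {x : H.carrier (Γ i) // supp _ x ⊆ D} => Formula.iAnd fun i =>
          Formula.eq (Term.fst i)
            (Term.snd (Γ := Γ) (Δ := fun p : H.PointsOver supp D => p.1) ⟨Γ i, t i⟩))))).2
    simp only [Formula.holds_exTuple, Formula.holds_and, Formula.holds_subst, Formula.holds_iOr,
      Formula.holds_iAnd, Formula.holds_eq, Term.realize_fst, Term.realize_snd] at h
    refine h (fun b => ?_) a
    obtain ⟨γ, hγ, hb⟩ := hD b
    exact ⟨fun p => γ⁻¹ p.1 p.2.1, (hfr _).2 ⟨γ⁻¹, inv_mem hγ, fun _ => rfl⟩,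
      fun i => ⟨_, hb i⟩, fun i => by simp⟩
  obtain ⟨C, hCD, hCK, hCinv⟩ := Struc.exists_invariant_support hact hint
    (K := Struc.classStabilizer E hEH fun i => (t i).1) (fun γ hγ => hγ.1) (D := D) (by
      intro γ hγ
      refine ⟨hγ.1, ?_⟩
      have : (fun i => γ _ (t i).1 : H.Tuple Γ) = fun i => (t i).1 :=
        funext fun i => hγ.2 _ _ (t i).2
      rw [this]
      exact hEH.refl _)
  have := hfin C
  let Ξ : H.PointsOver supp D → L.Sorts := fun p => p.1
  let ι : H.PointsOver supp C → H.PointsOver supp D := fun p => ⟨p.1, p.2.1, p.2.2.trans hCD⟩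
  let at' : Fin k → H.PointsOver supp D := fun i => ⟨Γ i, t i⟩
  let ψ := Formula.classOfPart (Ξ := Ξ) fr ι at' E
  have hψM : ∀ x : M.Tuple Γ, ψ.Holds M (Struc.Tuple.append x fun j => F (ι j)) ↔
      E.Holds M (Struc.Tuple.append x a) := by
    have h := (hM.forall_holds_iff (Γ := Sum.elim Ξ Γ) ((fr.subst Term.fst).imp
      ((ψ.subst₂ Term.snd fun j => Term.fst (Γ := Ξ) (ι j)).iff
        (E.subst₂ Term.snd fun i => Term.fst (Γ := Ξ) (at' i))))).2
    simp only [Formula.holds_imp, Formula.holds_iff, Formula.holds_subst, Formula.holds_subst₂] at h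
    have ha : a = fun i => F (at' i) := funext ht
    rw [ha]
    refine fun x => h (fun v hv => ?_) (Struc.Tuple.append F x) hF
    have hψ := Formula.holds_classOfPart H fr ι at' E (fun i => v (Sum.inr i))
      fun j => v (Sum.inl (ι j))
    refine hψ.trans ⟨?_, fun hE => ⟨fun p => v (Sum.inl p), hv, fun _ => rfl, hE⟩⟩
    rintro ⟨F', hF', hFF', hE⟩
    -- The two copies agree over `C`, so they differ by an automorphism stabilizing the class.
    obtain ⟨γ, hγ, hv⟩ := (hfr _).1 hv
    obtain ⟨γ', hγ', hv'⟩ := (hfr _).1 hF'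
    refine hEH.trans hE ?_
    have hmem : γ⁻¹ * γ' ∈ H.fixing supp C := by
      refine ⟨mul_mem (inv_mem hγ) hγ', fun s x hx => ?_⟩
      have h1 := hFF' ⟨s, x, hx⟩
      have h2 := hv (ι ⟨s, x, hx⟩)
      have h3 := hv' (ι ⟨s, x, hx⟩)
      rw [Pi.mul_apply, Equiv.Perm.mul_apply, Pi.inv_apply, Equiv.Perm.inv_eq_iff_eq]
      exact h3.symm.trans (h1.symm.trans h2)
    have h4 := (Struc.autGroup_holds_append hγ E _ _).2 (hCK hmem).2
    have h5 : (fun i => γ (Γ i) ((γ⁻¹ * γ') (Γ i) (t i).1) : H.Tuple Γ) = fun i => F' (at' i) := by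
      funext i
      rw [hv' (at' i)]
      simp [at']
    have h6 : (fun i => γ (Γ i) (t i).1 : H.Tuple Γ) = fun i => v (Sum.inl (at' i)) := by
      funext i
      exact (hv (at' i)).symm
    rw [h5, h6] at h4
    exact h4
  have hfinM : ∀ z : M.Tuple (fun j => Ξ (ι j)),
      (∀ x : M.Tuple Γ, ψ.Holds M (Struc.Tuple.append x z) ↔ E.Holds M (Struc.Tuple.append x a)) →
      ∃ t' : (j : H.PointsOver supp C) → {x : H.carrier j.1 // supp _ x ⊆ D},
        ∀ j, z j = F ⟨j.1, t' j⟩ := by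
    have h := (hM.forall_holds_iff (Γ := Sum.elim Ξ fun j => Ξ (ι j)) ((fr.subst Term.fst).imp
      ((Formula.allTuple (Δ := Γ)
        ((ψ.subst₂ Term.snd fun j => Term.fst (Γ := Sum.elim Ξ fun j => Ξ (ι j)) (Sum.inr j)).iff
          (E.subst₂ Term.snd
            fun i => Term.fst (Γ := Sum.elim Ξ fun j => Ξ (ι j)) (Sum.inl (at' i))))).imp
        (Formula.iOr
          fun t' : (j : H.PointsOver supp C) → {x : H.carrier j.1 // supp _ x ⊆ D} =>
            Formula.iAnd fun j => Formula.eq (s := j.1)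
              (Term.snd (Δ := fun j => Ξ (ι j)) j) (Term.fst (Γ := Ξ) ⟨j.1, t' j⟩))))).2
    simp only [Formula.holds_imp, Formula.holds_iff, Formula.holds_subst,
      Formula.holds_allTuple, Formula.holds_iOr, Formula.holds_iAnd, Formula.holds_eq] at h
    have ha : a = fun i => F (at' i) := funext ht
    rw [ha]
    refine fun z hz => h (fun v hv hψE => ?_) (Struc.Tuple.append F z) hF
      fun x => (Formula.holds_subst₂ M _ _ ψ _).trans
        ((hz x).trans (Formula.holds_subst₂ M Term.snd
          (fun i => Term.fst (Γ := Sum.elim Ξ fun j => Ξ (ι j)) (Sum.inl (at' i))) E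
          (Struc.Tuple.append (Struc.Tuple.append F z) x)).symm)
    have h1 := (Formula.holds_subst₂ H _ _ ψ _).1 ((hψE fun i => v (Sum.inl (at' i))).2
      ((Formula.holds_subst₂ H _ _ E _).2 (hEH.refl _)))
    obtain ⟨F', hF', hFF', hE⟩ := (Formula.holds_classOfPart H fr ι at' E
      (fun i => v (Sum.inl (at' i))) fun j => v (Sum.inr j)).1 h1
    obtain ⟨γ, hγ, hv⟩ := (hfr _).1 hv
    obtain ⟨γ', hγ', hv'⟩ := (hfr _).1 hF'
    -- `γ⁻¹ * γ'` stabilizes the class, so it maps points over `C` to points over `C ⊆ D`.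
    have hmem : γ⁻¹ * γ' ∈ Struc.classStabilizer E hEH fun i => (t i).1 := by
      refine ⟨mul_mem (inv_mem hγ) hγ', hEH.symm ?_⟩
      rw [← Struc.autGroup_holds_append hγ]
      have h5 : (fun i => γ (Γ i) ((γ⁻¹ * γ') (Γ i) (t i).1) : H.Tuple Γ) =
          fun i => F' (at' i) := by
        funext i
        rw [hv' (at' i)]
        simp [at']
      have h6 : (fun i => γ (Γ i) (t i).1 : H.Tuple Γ) = fun i => v (Sum.inl (at' i)) := by
        funext i
        exact (hv (at' i)).symm
      rw [h5, h6]
      exact hE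
    have hD' : ∀ j : H.PointsOver supp C, supp _ ((γ⁻¹ * γ') j.1 j.2.1) ⊆ D :=
      fun j => (hCinv _ hmem _ _ j.2.2).trans hCD
    refine ⟨fun j => ⟨_, hD' j⟩, fun j => ?_⟩
    refine (hFF' j).trans ((hv' (ι j)).trans (Eq.trans ?_ (hv ⟨j.1, _, hD' j⟩).symm))
    simp [ι]
  let e := (Finite.equivFin (H.PointsOver supp C)).symm
  let ψ' : L.Formula (Sum.elim Γ ((fun j => Ξ (ι j)) ∘ e)) :=
    ψ.subst₂ Term.fst fun j => (Term.reindexVar e j).subst fun j => Term.snd j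
  have hψ' : ∀ (x : M.Tuple Γ) (z : M.Tuple fun j => Ξ (ι j)),
      ψ'.Holds M (Struc.Tuple.append x fun j => z (e j)) ↔
        ψ.Holds M (Struc.Tuple.append x z) := by
    intro x z
    refine (Formula.holds_subst₂ M _ _ ψ _).trans (iff_of_eq ?_)
    congr 2
    funext j
    exact (Term.realize_subst M _ _ _).trans (Term.realize_reindexVar M _ z j)
  -- The variables `z` of `ψ`, indexed by the points over `C`, are enumerated by `Fin l`.
  refine ⟨_, _, ψ', {c | {x : M.Tuple Γ | ψ'.Holds M (Struc.Tuple.append x c)} =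
    {x : M.Tuple Γ | E.Holds M (Struc.Tuple.append x a)}}, ?_, ⟨fun j => F (ι (e j)), ?_⟩,
    fun _ => Iff.rfl⟩
  · refine (Set.finite_range
      fun (t' : (j : H.PointsOver supp C) → {x : H.carrier j.1 // supp _ x ⊆ D}) =>
        (fun j => F ⟨(e j).1, t' (e j)⟩ : M.Tuple ((fun j => Ξ (ι j)) ∘ e))).subset ?_
    intro c hc
    obtain ⟨z, rfl⟩ := Struc.Tuple.exists_reindex M e c
    obtain ⟨t', ht'⟩ := hfinM z fun x => (hψ' x z).symm.trans (Set.ext_iff.1 hc x)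
    exact ⟨t', funext fun j => (ht' (e j)).symm⟩
  · exact Set.ext fun x => (hψ' x fun j => F (ι j)).trans (hψM x)

end Support

end MSLanguage

namespace Polygroupoid

/-! ### Cochains of the full simplex on `ℕ` -/

section Cochains

variable {G : Type} [AddCommGroup G] {k : ℕ}

/-- Alternating `k`-cochains of the full simplex on `ℕ`, with values in `G`, as alternating forms
on the free abelian group on `ℕ`. -/
abbrev Cochain (G : Type) [AddCommGroup G] (k : ℕ) : Type :=
  (ℕ →₀ ℤ) [⋀^Fin k]→ₗ[ℤ] G

/-- The value of a cochain at a tuple of vertices. -/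
noncomputable def Cochain.val (u : Cochain G k) (w : Fin k → ℕ) : G :=
  u fun i => Finsupp.single (w i) 1

theorem Cochain.val_comp_perm (u : Cochain G k) (w : Fin k → ℕ) (σ : Equiv.Perm (Fin k)) :
    u.val (w ∘ σ) = ((Equiv.Perm.sign σ : ℤˣ) : ℤ) • u.val w :=
  u.map_perm (fun i => Finsupp.single (w i) 1) σ

/-- The linear form on the free abelian group that takes the value `1` at every vertex. -/
noncomputable def augmentation : (ℕ →₀ ℤ) →ₗ[ℤ] ℤ :=
  Finsupp.linearCombination ℤ fun _ => 1

/-- The coboundary of an alternating cochain, as the exterior product with the augmentation. -/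
noncomputable def coboundary (u : Cochain G k) : Cochain G (k + 1) :=
  AlternatingMap.alternatizeUncurryFin (augmentation.smulRight u)

theorem coboundary_val (u : Cochain G k) (w : Fin (k + 1) → ℕ) :
    (coboundary u).val w = ∑ i : Fin (k + 1), (-1 : ℤ) ^ (i : ℕ) • u.val (w ∘ i.succAbove) := by
  rw [coboundary, Cochain.val, AlternatingMap.alternatizeUncurryFin_apply]
  refine Finset.sum_congr rfl fun i _ => ?_
  simp [augmentation]
  rfl

theorem coboundary_coboundary (u : Cochain G k) : coboundary (coboundary u) = 0 := by
  have h := AlternatingMap.alternatizeUncurryFin_alternatizeUncurryFinLM_comp_of_symmetric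
    (f := (augmentation.smulRight (augmentation.smulRight u) :
      (ℕ →₀ ℤ) →ₗ[ℤ] (ℕ →₀ ℤ) →ₗ[ℤ] Cochain G k))
    (fun x y => by simp [smul_smul, mul_comm])
  rw [← h, coboundary]
  congr 1
  refine LinearMap.ext fun x => ?_
  simp [coboundary]

/-- A function on tuples of vertices that is alternating: it changes by the sign under
permutations and vanishes at tuples with a repeated entry. -/
structure IsAlternating (f : (Fin k → ℕ) → G) : Prop where
  comp_perm : ∀ (w : Fin k → ℕ) (σ : Equiv.Perm (Fin k)),
    f (w ∘ σ) = ((Equiv.Perm.sign σ : ℤˣ) : ℤ) • f w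
  eq_zero : ∀ w : Fin k → ℕ, ¬ Function.Injective w → f w = 0

/-- The cochain whose value at a tuple `w` of elements of `D` is `f w`, and which vanishes on
all other tuples. -/
noncomputable def cochainOf (D : Finset ℕ) {f : (Fin k → ℕ) → G} (hf : IsAlternating f) :
    Cochain G k where
  toMultilinearMap := ∑ w ∈ Fintype.piFinset fun _ : Fin k => D,
    ((MultilinearMap.mkPiAlgebra ℤ (Fin k) ℤ).compLinearMap
      fun i => Finsupp.lapply (w i)).smulRight (f w)
  map_eq_zero_of_eq' := by
    intro v i j hv hij
    suffices h : ∑ w ∈ Fintype.piFinset fun _ : Fin k => D, (∏ l, v l (w l)) • f w = 0 by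
      simpa using h
    -- The terms of `w` and of `w` with the entries `i` and `j` swapped cancel.
    refine Finset.sum_involution (fun w _ => w ∘ Equiv.swap i j) ?_ ?_ ?_ ?_
    · intro w _
      have h : ∏ l, v l ((w ∘ Equiv.swap i j) l) = ∏ l, v l (w l) := by
        rw [← Equiv.prod_comp (Equiv.swap i j)]
        refine Finset.prod_congr rfl fun l _ => ?_
        rcases eq_or_ne l i with rfl | hi
        · simp [hv]
        · rcases eq_or_ne l j with rfl | hj
          · simp [hv]
          · simp [Equiv.swap_apply_of_ne_of_ne hi hj]
      rw [h, hf.comp_perm, Equiv.Perm.sign_swap hij]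
      simp
    · intro w _ hne heq
      refine hne ?_
      rw [hf.eq_zero w fun hw => hij (hw ?_), smul_zero]
      simpa using (congrFun heq j)
    · intro w hw
      simp only [Fintype.mem_piFinset] at hw ⊢
      exact fun l => hw _
    · intro w _
      funext l
      simp

theorem cochainOf_val {D : Finset ℕ} {f : (Fin k → ℕ) → G} (hf : IsAlternating f)
    {w : Fin k → ℕ} (hw : ∀ i, w i ∈ D) : (cochainOf D hf).val w = f w := by
  have h : (cochainOf D hf).val w =
      ∑ w' ∈ Fintype.piFinset fun _ : Fin k => D,
        (∏ l, (Finsupp.single (w l) (1 : ℤ)) (w' l)) • f w' := by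
    simp [Cochain.val, cochainOf]
  rw [h, Finset.sum_eq_single w]
  · simp
  · intro w' _ hne
    obtain ⟨l, hl⟩ := Function.ne_iff.1 hne
    rw [Finset.prod_eq_zero (Finset.mem_univ l), zero_smul]
    exact Finsupp.single_eq_of_ne hl
  · intro h
    exact absurd (Fintype.mem_piFinset.2 hw) h

/-- The cone with apex `p`: the function `w ↦ g (p, w)` has coboundary `g` at the injective tuples
at which `g` is closed. -/
theorem IsAlternating.sum_cone {g : (Fin (k + 1) → ℕ) → G} (hg : IsAlternating g) {D : Set ℕ}
    (hcl : ∀ w : Fin (k + 2) → ℕ, Function.Injective w → (∀ i, w i ∈ D) →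
      ∑ i : Fin (k + 2), (-1 : ℤ) ^ (i : ℕ) • g (w ∘ i.succAbove) = 0)
    {p : ℕ} (hp : p ∈ D) {w : Fin (k + 1) → ℕ} (hw : Function.Injective w) (hwD : ∀ i, w i ∈ D) :
    ∑ i : Fin (k + 1), (-1 : ℤ) ^ (i : ℕ) •
      g (Fin.cons p (w ∘ i.succAbove) : Fin (k + 1) → ℕ) = g w := by
  by_cases hpw : p ∈ Set.range w
  · obtain ⟨j, rfl⟩ := hpw
    rw [Finset.sum_eq_single j]
    · have : (Fin.cons (w j) (w ∘ j.succAbove) : Fin (k + 1) → ℕ) = w ∘ j.cycleRange.symm := by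
        funext i
        refine Fin.cases ?_ (fun i => ?_) i
        · simp
        · simp
      rw [this, hg.comp_perm, Equiv.Perm.sign_symm, Fin.sign_cycleRange, smul_smul]
      simp [← mul_pow]
    · intro i _ hij
      obtain ⟨l, rfl⟩ := Fin.exists_succAbove_eq hij.symm
      rw [hg.eq_zero _ fun h => ?_, smul_zero]
      exact Fin.succ_ne_zero l (h (by simp))
    · simp
  · have h := hcl (Fin.cons p w) (Fin.cons_injective_iff.2 ⟨hpw, hw⟩)
      (Fin.cases hp hwD)
    rw [Fin.sum_univ_succ] at h
    have h0 : (Fin.cons p w : Fin (k + 2) → ℕ) ∘ (0 : Fin (k + 2)).succAbove = w := by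
      funext i; simp
    have hs : ∀ i : Fin (k + 1), (Fin.cons p w : Fin (k + 2) → ℕ) ∘ i.succ.succAbove =
        Fin.cons p (w ∘ i.succAbove) := by
      intro i
      funext j
      refine Fin.cases ?_ (fun j => ?_) j <;> simp
    simp only [h0, hs, Fin.val_succ, pow_succ, Fin.val_zero, pow_zero, one_smul, mul_neg, mul_one,
      neg_smul, Finset.sum_neg_distrib] at h
    exact (eq_of_sub_eq_zero (by rw [sub_eq_add_neg]; exact h)).symm

theorem IsAlternating.cone {g : (Fin (k + 1) → ℕ) → G} (hg : IsAlternating g) (p : ℕ) :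
    IsAlternating fun w : Fin k → ℕ => g (Fin.cons p w : Fin (k + 1) → ℕ) where
  comp_perm w σ := by
    have : (Fin.cons p (w ∘ σ) : Fin (k + 1) → ℕ) =
        (Fin.cons p w : Fin (k + 1) → ℕ) ∘ Equiv.Perm.decomposeFin.symm (0, σ) := by
      funext i
      refine Fin.cases ?_ (fun i => ?_) i <;> simp
    simp only [this, hg.comp_perm, Equiv.Perm.decomposeFin.symm_sign, if_true, one_mul]
  eq_zero w hw := hg.eq_zero _ fun h => hw (Fin.cons_injective_iff.1 h).2

/-- The full simplex on `D` is acyclic relative to the full simplex on a subset `C`: a closed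
alternating function vanishing on `C` is the coboundary of an alternating function vanishing
on `C`. -/
theorem IsAlternating.exists_primitive {g : (Fin (k + 2) → ℕ) → G} (hg : IsAlternating g)
    {C D : Set ℕ} (hCD : C ⊆ D)
    (hcl : ∀ w : Fin (k + 3) → ℕ, Function.Injective w → (∀ i, w i ∈ D) →
      ∑ i : Fin (k + 3), (-1 : ℤ) ^ (i : ℕ) • g (w ∘ i.succAbove) = 0)
    (hC : ∀ w : Fin (k + 2) → ℕ, (∀ i, w i ∈ C) → g w = 0) :
    ∃ f : (Fin (k + 1) → ℕ) → G, IsAlternating f ∧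
      (∀ w : Fin (k + 2) → ℕ, Function.Injective w → (∀ i, w i ∈ D) →
        ∑ i : Fin (k + 2), (-1 : ℤ) ^ (i : ℕ) • f (w ∘ i.succAbove) = g w) ∧
      ∀ w : Fin (k + 1) → ℕ, (∀ i, w i ∈ C) → f w = 0 := by
  rcases C.eq_empty_or_nonempty with rfl | ⟨p, hp⟩
  · rcases D.eq_empty_or_nonempty with rfl | ⟨p, hp⟩
    · exact ⟨fun _ => 0, ⟨by simp, by simp⟩, fun w _ hw => (hw 0).elim, fun _ _ => rfl⟩
    · exact ⟨_, hg.cone p, fun w hw hwD => hg.sum_cone hcl hp hw hwD, fun w hw => (hw 0).elim⟩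
  · exact ⟨_, hg.cone p, fun w hw hwD => hg.sum_cone hcl (hCD hp) hw hwD,
      fun w hw => hC _ (Fin.cases hp hw)⟩

open Classical in
/-- The restriction of an alternating function to the tuples of elements of `A`, extended
by zero. -/
theorem IsAlternating.restrict {f : (Fin k → ℕ) → G} (hf : IsAlternating f) (A : Set ℕ) :
    IsAlternating fun w => if ∀ i, w i ∈ A then f w else 0 where
  comp_perm w σ := by
    have : (∀ i, (w ∘ σ) i ∈ A) ↔ ∀ i, w i ∈ A :=
      σ.forall_congr_right (q := fun i => w i ∈ A)
    simp only [this, hf.comp_perm]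
    split_ifs <;> simp
  eq_zero w hw := by simp [hf.eq_zero w hw]

end Cochains

/-! ### Permutations of `ℕ` -/

theorem exists_perm_eqOn {S : Finset ℕ} {f : ℕ → ℕ} (hf : Set.InjOn f S) :
    ∃ σ : Equiv.Perm ℕ, ∀ x ∈ S, σ x = f x := by
  have h := Equiv.Perm.isMultiplyPretransitive ℕ S.card
  let e := S.equivFin.symm
  obtain ⟨σ, hσ⟩ := h.exists_smul_eq
    ⟨fun i => (e i : ℕ), fun i j hij => e.injective (Subtype.ext hij)⟩
    ⟨fun i => f (e i), fun i j hij => e.injective (Subtype.ext (hf (e i).2 (e j).2 hij))⟩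
  refine ⟨σ, fun x hx => ?_⟩
  obtain ⟨i, hi⟩ := e.surjective ⟨x, hx⟩
  have := DFunLike.congr_fun hσ i
  change σ (e i) = f (e i) at this
  rwa [hi] at this

/-- A permutation fixing `A ∩ B` is, up to permutations fixing `A`, conjugate by a permutation
fixing `A` to one that fixes `B`: it suffices to move `B \ A` away from `A` and its image. -/
theorem exists_perm_factorization {A B : Finset ℕ} {σ : Equiv.Perm ℕ}
    (hσ : ∀ x ∈ A ∩ B, σ x = x) :
    ∃ ρ τ : Equiv.Perm ℕ, (∀ x ∈ A, ρ x = x) ∧ (∀ x ∈ B, (ρ⁻¹ * τ * ρ) x = x) ∧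
      ∀ x ∈ A, (τ⁻¹ * σ) x = x := by
  classical
  obtain ⟨N, hN⟩ : ∃ N, ∀ x ∈ A ∪ A.image σ, x < N :=
    ⟨_, fun x hx => Nat.lt_succ_of_le (Finset.le_sup (f := id) hx)⟩
  have hA : ∀ x ∈ A, x < N := fun x hx => hN x (Finset.mem_union_left _ hx)
  have hσA : ∀ x ∈ A, σ x < N := fun x hx =>
    hN _ (Finset.mem_union_right _ (Finset.mem_image_of_mem _ hx))
  -- `ρ` shifts `B \ A` beyond `N`, that is, beyond `A` and `σ A`.
  obtain ⟨ρ, hρ⟩ := exists_perm_eqOn (S := A ∪ B) (f := fun x => if x ∈ A then x else x + N) (by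
    intro x _ y _ hxy
    have hx := hA x
    have hy := hA y
    simp only at hxy
    split_ifs at hxy with h1 h2 h2
    · exact hxy
    · have := hx h1; omega
    · have := hy h2; omega
    · omega)
  have hρA : ∀ x ∈ A, ρ x = x := fun x hx => by
    rw [hρ x (Finset.mem_union_left _ hx), if_pos hx]
  have hρB : ∀ x ∈ B, x ∉ A → N ≤ ρ x := fun x hx hxA => by
    rw [hρ x (Finset.mem_union_right _ hx), if_neg hxA]
    omega
  -- So `τ` can be prescribed as `σ` on `A` and as the identity on `ρ B`.
  obtain ⟨τ, hτ⟩ := exists_perm_eqOn (S := A ∪ B.image ρ) (f := fun x => if x ∈ A then σ x else x)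
    (by
      have key : ∀ x ∈ A, ∀ y ∈ A ∪ B.image ρ, y ∉ A → σ x ≠ y := by
        rintro x hx y hy hyA rfl
        rcases Finset.mem_union.1 hy with h | h
        · exact hyA h
        · obtain ⟨z, hz, hzy⟩ := Finset.mem_image.1 h
          by_cases hzA : z ∈ A
          · rw [hρA z hzA] at hzy
            exact hyA (hzy ▸ hzA)
          · exact absurd (hσA x hx) (by rw [← hzy]; exact not_lt.2 (hρB z hz hzA))
      intro x hx y hy hxy
      simp only at hxy
      split_ifs at hxy with h1 h2 h2
      · exact σ.injective hxy
      · exact (key x h1 y hy h2 hxy).elim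
      · exact (key y h2 x hx h1 hxy.symm).elim
      · exact hxy)
  have hτA : ∀ x ∈ A, τ x = σ x := fun x hx => by
    rw [hτ x (Finset.mem_union_left _ hx), if_pos hx]
  refine ⟨ρ, τ, hρA, fun x hx => ?_, fun x hx => ?_⟩
  · rw [Equiv.Perm.mul_apply, Equiv.Perm.mul_apply, Equiv.Perm.inv_eq_iff_eq]
    by_cases hxA : x ∈ A
    · rw [hρA x hxA, hτA x hxA, hσ x (Finset.mem_inter.2 ⟨hxA, hx⟩)]
    · rw [hτ _ (Finset.mem_union_right _ (Finset.mem_image_of_mem _ hx)), if_neg]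
      exact fun h => absurd (hA _ h) (not_lt.2 (hρB x hx hxA))
  · rw [Equiv.Perm.mul_apply, Equiv.Perm.inv_eq_iff_eq, hτA x hx]

end Polygroupoid

namespace Polygroupoid

open MSLanguage

variable {G : Type} {m : ℕ}

/-! ### Points, supports and copies -/

/-- The support of a point: the set of vertices that occur in it. -/
def supp : (s : Srt m) → carrier G m s → Finset ℕ
  | .low _, w => Finset.univ.map w
  | .top, p => Finset.univ.map p.1
  | .grp, _ => ∅

theorem supp_low_subset {D : Finset ℕ} {k : Fin (m + 1)} {w : Fin (k + 1) ↪ ℕ} :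
    supp (G := G) (.low k) w ⊆ D ↔ ∀ i, w i ∈ D := by
  simp [supp, Finset.subset_iff]

theorem supp_top_subset {D : Finset ℕ} {p : (Fin (m + 2) ↪ ℕ) × G} :
    supp (.top : Srt m) p ⊆ D ↔ ∀ i, p.1 i ∈ D := by
  simp [supp, Finset.subset_iff]

variable [AddCommGroup G]

/-- The expansion of `H_{G,n}` by constants for the elements of `G`. -/
def namedModel (G : Type) [AddCommGroup G] (m : ℕ) : (namedLanguage G m).Struc :=
  (standardModel G m).nameConstants (C := G) (srt := fun _ => Srt.grp)
    fun g => (g : carrier G m Srt.grp)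

/-- A function symbol does not add vertices. -/
theorem supp_funMap_subset {D : Finset ℕ} (f : (namedLanguage G m).Fn)
    (x : (i : Fin ((namedLanguage G m).fnArity f)) →
      (namedModel G m).carrier ((namedLanguage G m).fnDom f i))
    (hx : ∀ i, supp (G := G) (m := m) _ (x i) ⊆ D) :
    supp (G := G) (m := m) _ ((namedModel G m).funMap f x) ⊆ D := by
  rcases f with (⟨k, i⟩ | ⟨i⟩ | _ | _ | ⟨σ⟩) | g
  · exact supp_low_subset.2 fun j => supp_low_subset.1 (hx (0 : Fin 1)) _
  · exact supp_low_subset.2 fun j => supp_top_subset.1 (hx (0 : Fin 1)) _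
  · exact Finset.empty_subset _
  · exact hx (1 : Fin 2)
  · exact supp_top_subset.2 fun j => supp_top_subset.1 (hx (0 : Fin 1)) _
  · exact Finset.empty_subset _

/-- `F` copies the points over `D`: on these points it commutes with the function symbols,
preserves `Q` and is injective on vertices. Its values at other points are irrelevant. -/
structure IsCopyOn (D : Finset ℕ) (F : (s : Srt m) → carrier G m s → carrier G m s) : Prop where
  map_fn : ∀ (f : (namedLanguage G m).Fn) (x : (i : Fin ((namedLanguage G m).fnArity f)) →
      (namedModel G m).carrier ((namedLanguage G m).fnDom f i)),
    (∀ i, supp (G := G) (m := m) _ (x i) ⊆ D) →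
      F _ ((namedModel G m).funMap f x) = (namedModel G m).funMap f fun i => F _ (x i)
  map_rel : ∀ x : Fin (m + 3) → (Fin (m + 2) ↪ ℕ) × G, (∀ i, supp (.top : Srt m) (x i) ⊆ D) →
    QRel x → QRel (G := G) fun i => F .top (x i)
  inj : ∀ v w : Fin ((0 : Fin (m + 1)) + 1) ↪ ℕ, supp (G := G) (.low 0) v ⊆ D →
    supp (G := G) (.low 0) w ⊆ D → F (.low 0) v = F (.low 0) w → v = w

theorem isCopyOn_of_mem_autGroup {γ : (s : Srt m) → Equiv.Perm (carrier G m s)}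
    (hγ : γ ∈ (namedModel G m).autGroup) (D : Finset ℕ) : IsCopyOn D fun s => γ s where
  map_fn f x _ := hγ.1 f x
  map_rel x _ hx := (hγ.2 () x).2 hx
  inj _ _ _ _ h := (γ _).injective h

/-- The action of `F` on the sort `P_{k+1}`, on underlying tuples. -/
def onLow (F : (s : Srt m) → carrier G m s → carrier G m s) (k : Fin (m + 1))
    (w : Fin (k + 1) ↪ ℕ) : Fin (k + 1) ↪ ℕ :=
  F (.low k) w

/-- The action of `F` on the sort `P_n`, on underlying pairs. -/
def onTop (F : (s : Srt m) → carrier G m s → carrier G m s) (p : (Fin (m + 2) ↪ ℕ) × G) :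
    (Fin (m + 2) ↪ ℕ) × G :=
  F .top p

theorem subsingleton_index_zero : Subsingleton (Fin ((0 : Fin (m + 1)) + 1)) :=
  inferInstanceAs (Subsingleton (Fin 1))

/-- The vertex `v` as a point of the sort `I`. -/
def vertex (m : ℕ) (v : ℕ) : Fin ((0 : Fin (m + 1)) + 1) ↪ ℕ where
  toFun _ := v
  inj' _ _ _ := subsingleton_index_zero.elim _ _

theorem eq_vertex (w : Fin ((0 : Fin (m + 1)) + 1) ↪ ℕ) (j : Fin ((0 : Fin (m + 1)) + 1)) :
    w = vertex m (w j) :=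
  DFunLike.ext _ _ fun i => congrArg w (subsingleton_index_zero.elim i j)

/-- The action of `F` on the vertices. -/
def vertexMap (F : (s : Srt m) → carrier G m s → carrier G m s) (v : ℕ) : ℕ :=
  onLow F 0 (vertex m v) 0

open Classical in
/-- The translation by which `F` acts on the fibres over the injective tuples of elements of `D`,
extended by zero to all tuples. -/
noncomputable def fibreShift (D : Finset ℕ) (F : (s : Srt m) → carrier G m s → carrier G m s)
    (w : Fin (m + 2) → ℕ) : G :=
  if h : Function.Injective w ∧ ∀ i, w i ∈ D then (onTop F (⟨w, h.1⟩, 0)).2 else 0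

theorem fibreShift_coe {D : Finset ℕ} (F : (s : Srt m) → carrier G m s → carrier G m s)
    {w : Fin (m + 2) ↪ ℕ} (hw : ∀ i, w i ∈ D) : fibreShift D F w = (onTop F (w, 0)).2 :=
  dif_pos ⟨w.injective, hw⟩

namespace IsCopyOn

variable {D : Finset ℕ} {F : (s : Srt m) → carrier G m s → carrier G m s}

theorem map_grp (hF : IsCopyOn D F) (g : G) : F .grp g = g :=
  hF.map_fn (Sum.inr g) (fun i => i.elim0) fun i => i.elim0

theorem onLow_apply (hF : IsCopyOn D F) (k : Fin (m + 1)) :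
    ∀ w : Fin (k + 1) ↪ ℕ, (∀ i, w i ∈ D) → ∀ j, onLow F k w j = vertexMap F (w j) := by
  induction k using Fin.induction with
  | zero =>
    intro w hw j
    rw [vertexMap, ← eq_vertex w j, subsingleton_index_zero.elim 0 j]
  | succ k ih =>
    intro w hw j
    have : Nontrivial (Fin (k.succ + 1)) := inferInstanceAs (Nontrivial (Fin (k + 2)))
    obtain ⟨i, hi⟩ := exists_ne j
    obtain ⟨l, rfl⟩ := Fin.exists_succAbove_eq hi.symm
    have h : onLow F k.castSucc (face i w) = face i (onLow F k.succ w) :=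
      hF.map_fn (Sum.inl (.projLow k i)) (fun _ => w) fun _ => supp_low_subset.2 hw
    have h' := ih (face i w) (fun _ => hw _) l
    rw [h] at h'
    exact h'

theorem onTop_fst_apply (hF : IsCopyOn D F) (p : (Fin (m + 2) ↪ ℕ) × G) (hp : ∀ i, p.1 i ∈ D)
    (j : Fin (m + 2)) : (onTop F p).1 j = vertexMap F (p.1 j) := by
  obtain ⟨i, hi⟩ : ∃ i : Fin (m + 2), i ≠ j := exists_ne j
  obtain ⟨l, rfl⟩ := Fin.exists_succAbove_eq hi.symm
  have h : onLow F (Fin.last m) (face i p.1) = face i (onTop F p).1 :=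
    hF.map_fn (Sum.inl (.projTop i)) (fun _ => p) fun _ => supp_top_subset.2 hp
  have h' := hF.onLow_apply (Fin.last m) (face i p.1) (fun _ => hp _) l
  rw [h] at h'
  exact h'

theorem onTop_snd (hF : IsCopyOn D F) (p : (Fin (m + 2) ↪ ℕ) × G) (hp : ∀ i, p.1 i ∈ D) :
    (onTop F p).2 = fibreShift D F p.1 + p.2 := by
  let x : (i : Fin 2) → carrier G m ((![.grp, .top] : Fin 2 → Srt m) i) := fun i => match i with
    | 0 => p.2
    | 1 => ((p.1, 0) : (Fin (m + 2) ↪ ℕ) × G)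
  have h : onTop F (p.1, 0 + p.2) = actMap (G := G) (F .grp p.2) (onTop F (p.1, 0)) :=
    hF.map_fn (Sum.inl .act) x
      fun i => match i with
        | (0 : Fin 2) => Finset.empty_subset _
        | (1 : Fin 2) => supp_top_subset.2 hp
  rw [hF.map_grp, zero_add] at h
  rw [fibreShift_coe F hp, h]
  rfl

theorem isAlternating_fibreShift (hF : IsCopyOn D F) : IsAlternating (fibreShift D F) where
  comp_perm w σ := by
    by_cases h : Function.Injective w ∧ ∀ i, w i ∈ D
    · have h' : onTop F (invMap σ (⟨w, h.1⟩, 0)) = invMap σ (onTop F (⟨w, h.1⟩, 0)) :=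
        hF.map_fn (Sum.inl (.inv σ)) (fun _ => (⟨w, h.1⟩, (0 : G)))
          fun _ => supp_top_subset.2 h.2
      have h1 := fibreShift_coe F (w := ⟨w, h.1⟩) h.2
      have h2 := fibreShift_coe F (w := σ.toEmbedding.trans ⟨w, h.1⟩) (D := D) fun i => h.2 _
      have h3 : invMap σ ((⟨w, h.1⟩, 0) : (Fin (m + 2) ↪ ℕ) × G) =
          (σ.toEmbedding.trans ⟨w, h.1⟩, 0) := by
        simp [invMap]
      rw [h3] at h'
      rw [h'] at h2
      exact h2.trans (congrArg (((Equiv.Perm.sign σ : ℤˣ) : ℤ) • ·) h1.symm)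
    · rw [fibreShift, fibreShift, dif_neg h, dif_neg, smul_zero]
      rintro ⟨h1, h2⟩
      exact h ⟨(σ.injective_comp w).1 h1, fun i => by simpa using h2 (σ.symm i)⟩
  eq_zero w hw := dif_neg fun h => hw h.1

theorem sum_fibreShift (hF : IsCopyOn D F) {w : Fin (m + 3) → ℕ} (hw : Function.Injective w)
    (hwD : ∀ i, w i ∈ D) :
    ∑ i : Fin (m + 3), (-1 : ℤ) ^ (i : ℕ) • fibreShift D F (w ∘ i.succAbove) = 0 := by
  have h := (hF.map_rel (fun i => (face i ⟨w, hw⟩, 0))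
    (fun i => supp_top_subset.2 fun j => hwD _) ⟨⟨⟨w, hw⟩, fun _ => rfl⟩, by simp⟩).2
  simp only [pow_succ, mul_neg, mul_one, neg_smul, Finset.sum_neg_distrib, neg_eq_zero] at h
  refine Eq.trans (Finset.sum_congr rfl fun i _ => ?_) h
  exact congrArg _ (fibreShift_coe F (w := face i ⟨w, hw⟩) fun j => hwD _)

theorem injOn_vertexMap (hF : IsCopyOn D F) : Set.InjOn (vertexMap F) D := by
  intro v hv w hw h
  have h1 := hF.inj (vertex m v) (vertex m w) (supp_low_subset.2 fun _ => hv)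
    (supp_low_subset.2 fun _ => hw) ?_
  · exact DFunLike.congr_fun h1 0
  · exact (eq_vertex (onLow F 0 (vertex m v)) 0).trans
      ((congrArg (vertex m) h).trans (eq_vertex (onLow F 0 (vertex m w)) 0).symm)

end IsCopyOn

/-! ### Automorphisms of the standard structure -/

/-- The action of a permutation `σ` of the vertices on tuples of vertices. -/
def tupleEquiv (k : ℕ) (σ : Equiv.Perm ℕ) : Equiv.Perm (Fin k ↪ ℕ) where
  toFun w := w.trans σ.toEmbedding
  invFun w := w.trans σ.symm.toEmbedding
  left_inv w := DFunLike.ext _ _ fun i => σ.symm_apply_apply (w i)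
  right_inv w := DFunLike.ext _ _ fun i => σ.apply_symm_apply (w i)

/-- The permutation of the sort `P_n` that translates the fibres by a cochain and then acts by `σ`
on the tuples of vertices. -/
noncomputable def topEquiv (σ : Equiv.Perm ℕ) (h : Cochain G (m + 2)) :
    Equiv.Perm ((Fin (m + 2) ↪ ℕ) × G) where
  toFun p := (tupleEquiv _ σ p.1, h.val p.1 + p.2)
  invFun p := ((tupleEquiv _ σ).symm p.1, -h.val ((tupleEquiv _ σ).symm p.1) + p.2)
  left_inv p := by simp
  right_inv p := by simp

/-- The automorphism that translates the fibres by a cochain and then permutes the vertices. -/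
noncomputable def autOf (σ : Equiv.Perm ℕ) (h : Cochain G (m + 2)) :
    (s : Srt m) → Equiv.Perm (carrier G m s)
  | .low k => tupleEquiv (k + 1) σ
  | .top => topEquiv σ h
  | .grp => 1

theorem sum_val_face {h : Cochain G (m + 2)} (hh : coboundary h = 0) (a : Fin (m + 3) ↪ ℕ) :
    ∑ i : Fin (m + 3), (-1 : ℤ) ^ (i : ℕ) • h.val (face i a) = 0 := by
  have := coboundary_val h a
  rw [hh] at this
  exact this.symm

theorem qRel_topEquiv (σ : Equiv.Perm ℕ) {h : Cochain G (m + 2)} (hh : coboundary h = 0)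
    (x : Fin (m + 3) → (Fin (m + 2) ↪ ℕ) × G) :
    QRel (fun i => topEquiv σ h (x i)) ↔ QRel x := by
  have hface : ∀ (a : Fin (m + 3) ↪ ℕ) (i : Fin (m + 3)),
      tupleEquiv _ σ (face i a) = face i (tupleEquiv _ σ a) := fun _ _ => rfl
  have hex : (∃ a : Fin (m + 3) ↪ ℕ, ∀ i, (topEquiv σ h (x i)).1 = face i a) ↔
      ∃ a : Fin (m + 3) ↪ ℕ, ∀ i, (x i).1 = face i a := by
    constructor
    · rintro ⟨a, ha⟩
      refine ⟨(tupleEquiv _ σ).symm a, fun i => (tupleEquiv _ σ).injective ?_⟩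
      rw [hface, Equiv.apply_symm_apply]
      exact ha i
    · rintro ⟨a, ha⟩
      exact ⟨tupleEquiv _ σ a, fun i => (congrArg (tupleEquiv _ σ) (ha i)).trans (hface a i)⟩
  unfold QRel
  rw [hex]
  refine and_congr_right ?_
  rintro ⟨a, ha⟩
  have h0 : ∑ i : Fin (m + 3), (-1 : ℤ) ^ ((i : ℕ) + 1) • h.val (x i).1 = 0 := by
    simp only [ha, pow_succ, mul_neg, mul_one, neg_smul, Finset.sum_neg_distrib, sum_val_face hh,
      neg_zero]
  have h1 : ∑ i : Fin (m + 3), (-1 : ℤ) ^ ((i : ℕ) + 1) • (topEquiv σ h (x i)).2 =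
      ∑ i : Fin (m + 3), (-1 : ℤ) ^ ((i : ℕ) + 1) • (x i).2 := by
    rw [← zero_add (∑ i : Fin (m + 3), (-1 : ℤ) ^ ((i : ℕ) + 1) • (x i).2), ← h0,
      ← Finset.sum_add_distrib]
    exact Finset.sum_congr rfl fun i _ => smul_add _ _ _
  rw [h1]

theorem autOf_mem_autGroup (σ : Equiv.Perm ℕ) {h : Cochain G (m + 2)} (hh : coboundary h = 0) :
    autOf σ h ∈ (namedModel G m).autGroup := by
  refine ⟨fun f x => ?_, fun _ x => qRel_topEquiv σ hh x⟩
  rcases f with (⟨k, i⟩ | ⟨i⟩ | _ | _ | ⟨τ⟩) | g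
  · rfl
  · rfl
  · rfl
  · exact Prod.ext rfl (add_assoc (G := G) _ _ _).symm
  · have key : ∀ p : (Fin (m + 2) ↪ ℕ) × G,
        topEquiv σ h (invMap τ p) = invMap τ (topEquiv σ h p) := by
      intro p
      refine Prod.ext rfl ?_
      exact (congrArg (· + _) (h.val_comp_perm p.1 τ)).trans (smul_add _ _ _).symm
    exact key (x (0 : Fin 1))
  · rfl

theorem autOf_mul (σ τ : Equiv.Perm ℕ) :
    autOf (σ * τ) (0 : Cochain G (m + 2)) = autOf σ 0 * autOf τ 0 := by
  funext s
  refine Equiv.ext fun x => ?_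
  cases s with
  | low k => rfl
  | top => exact Prod.ext rfl (zero_add _).symm
  | grp => rfl

/-- The action of the permutations of the vertices by automorphisms. -/
noncomputable def permAut (G : Type) [AddCommGroup G] (m : ℕ) :
    Equiv.Perm ℕ →* ((s : Srt m) → Equiv.Perm (carrier G m s)) :=
  MonoidHom.mk' (fun σ => autOf σ 0) autOf_mul

theorem coboundary_zero {k : ℕ} : coboundary (0 : Cochain G k) = 0 := by
  ext
  simp [coboundary, AlternatingMap.alternatizeUncurryFin_apply]

theorem autOf_mem_fixing {σ : Equiv.Perm ℕ} {h : Cochain G (m + 2)} (hh : coboundary h = 0)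
    {A : Finset ℕ} (hσ : ∀ x ∈ A, σ x = x)
    (hA : ∀ w : Fin (m + 2) ↪ ℕ, (∀ i, w i ∈ A) → h.val w = 0) :
    autOf σ h ∈ (namedModel G m).fixing (supp (m := m)) A := by
  refine ⟨autOf_mem_autGroup σ hh, fun s x hx => ?_⟩
  rcases s with k | _ | _
  · exact DFunLike.ext (F := Fin (k + 1) ↪ ℕ) _ _ fun i => hσ _ (supp_low_subset.1 hx i)
  · have hx' := supp_top_subset.1 hx
    refine Prod.ext (DFunLike.ext (F := Fin (m + 2) ↪ ℕ) _ _ fun i => hσ _ (hx' i)) ?_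
    refine (congrArg (· + _) (hA _ hx')).trans (zero_add _)
  · rfl

theorem permAut_mem_fixing {σ : Equiv.Perm ℕ} {A : Finset ℕ} (hσ : ∀ x ∈ A, σ x = x) :
    permAut G m σ ∈ (namedModel G m).fixing (supp (m := m)) A :=
  autOf_mem_fixing coboundary_zero hσ fun _ _ => rfl

end Polygroupoid

namespace Polygroupoid

open MSLanguage

variable {G : Type} [AddCommGroup G] {m : ℕ}

/-! ### Automorphisms determined over finite sets -/

theorem coboundary_cochainOf_val {k : ℕ} {D : Finset ℕ} {f : (Fin k → ℕ) → G}
    (hf : IsAlternating f) {w : Fin (k + 1) → ℕ} (hw : ∀ i, w i ∈ D) :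
    (coboundary (cochainOf D hf)).val w =
      ∑ i : Fin (k + 1), (-1 : ℤ) ^ (i : ℕ) • f (w ∘ i.succAbove) := by
  rw [coboundary_val]
  exact Finset.sum_congr rfl fun i _ => congrArg _ (cochainOf_val hf fun j => hw _)

/-- A copy of the points over `D` is the restriction of an automorphism: its translations of the
fibres form a cocycle on `D`, hence a coboundary. -/
theorem IsCopyOn.exists_aut {D : Finset ℕ} {F : (s : Srt m) → carrier G m s → carrier G m s}
    (hF : IsCopyOn D F) :
    ∃ γ ∈ (namedModel G m).autGroup, ∀ s x, supp s x ⊆ D → F s x = γ s x := by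
  obtain ⟨σ, hσ⟩ := exists_perm_eqOn hF.injOn_vertexMap
  obtain ⟨f, hf, hfg, -⟩ := hF.isAlternating_fibreShift.exists_primitive
    (Set.empty_subset (D : Set ℕ)) (fun w hw hwD => hF.sum_fibreShift hw hwD)
    fun w hw => (hw 0).elim
  refine ⟨autOf σ (coboundary (cochainOf D hf)),
    autOf_mem_autGroup σ (coboundary_coboundary _), fun s x hx => ?_⟩
  rcases s with k | _ | _
  · have hx' := supp_low_subset.1 hx
    exact DFunLike.ext (F := Fin (k + 1) ↪ ℕ) _ _ fun j =>
      (hF.onLow_apply k x hx' j).trans (hσ _ (hx' j)).symm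
  · have hx' := supp_top_subset.1 hx
    refine Prod.ext (DFunLike.ext (F := Fin (m + 2) ↪ ℕ) _ _ fun j =>
      (hF.onTop_fst_apply x hx' j).trans (hσ _ (hx' j)).symm) ((hF.onTop_snd x hx').trans ?_)
    exact congrArg (· + _)
      ((coboundary_cochainOf_val hf hx').trans (hfg _ (Function.Embedding.injective _) hx')).symm
  · exact hF.map_grp x

theorem exists_perm_of_mem_autGroup {γ : (s : Srt m) → Equiv.Perm (carrier G m s)}
    (hγ : γ ∈ (namedModel G m).autGroup) :
    ∃ σ : Equiv.Perm ℕ, (∀ k w, onLow (fun s => γ s) k w = tupleEquiv _ σ w) ∧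
      ∀ p, (onTop (fun s => γ s) p).1 = tupleEquiv _ σ p.1 := by
  have hcopy := isCopyOn_of_mem_autGroup hγ
  have hbij : Function.Bijective (vertexMap fun s => γ s) := by
    constructor
    · intro v w h
      exact (hcopy {v, w}).injOn_vertexMap (by simp) (by simp) h
    · intro v
      let w : Fin ((0 : Fin (m + 1)) + 1) ↪ ℕ := (γ (.low 0)).symm (vertex m v)
      refine ⟨w 0, ?_⟩
      have h : onLow (fun s => γ s) 0 w = vertex m v := (γ (.low 0)).apply_symm_apply _
      rw [vertexMap, ← eq_vertex w 0, h]
      rfl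
  refine ⟨Equiv.ofBijective _ hbij, fun k w => DFunLike.ext _ _ fun j => ?_,
    fun p => DFunLike.ext _ _ fun j => ?_⟩
  · exact (hcopy (Finset.univ.map w)).onLow_apply k w (fun i => by simp) j
  · exact (hcopy (Finset.univ.map p.1)).onTop_fst_apply p (fun i => by simp) j

theorem exists_perm_supp {γ : (s : Srt m) → Equiv.Perm (carrier G m s)}
    (hγ : γ ∈ (namedModel G m).autGroup) :
    ∃ σ : Equiv.Perm ℕ, ∀ s x, supp s (γ s x) = (supp s x).map σ.toEmbedding := by
  obtain ⟨σ, hlow, htop⟩ := exists_perm_of_mem_autGroup hγ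
  refine ⟨σ, fun s x => ?_⟩
  rcases s with k | _ | _
  · exact (congrArg (Finset.univ.map ·) (hlow k x)).trans (Finset.map_map _ _ _).symm
  · exact (congrArg (Finset.univ.map ·) (htop x)).trans (Finset.map_map _ _ _).symm
  · rfl

/-- The automorphisms fixing all points over `A ∩ B` are generated by those fixing all points
over `A` and those fixing all points over `B`. The permutation of the vertices is dealt with by
`exists_perm_factorization`. The translations of the fibres form a cocycle that vanishes over
`A ∩ B`, so over `A ∪ B` it is the coboundary of some `f` that vanishes over `A ∩ B`. The
restriction of `f` to the tuples in `A`, extended by zero, vanishes over `B`, and its coboundary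
agrees with the cocycle over `A`. -/
theorem fixing_inter_le (A B : Finset ℕ) :
    (namedModel G m).fixing (supp (m := m)) (A ∩ B) ≤
      (namedModel G m).fixing (supp (m := m)) A ⊔ (namedModel G m).fixing (supp (m := m)) B := by
  classical
  let K : Subgroup ((s : Srt m) → Equiv.Perm (carrier G m s)) :=
    (namedModel G m).fixing (supp (m := m)) A ⊔ (namedModel G m).fixing (supp (m := m)) B
  have hA : (namedModel G m).fixing (supp (m := m)) A ≤ K := le_sup_left
  have hB : (namedModel G m).fixing (supp (m := m)) B ≤ K := le_sup_right
  have hKaut : K ≤ (namedModel G m).autGroup := sup_le (fun _ h => h.1) fun _ h => h.1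
  suffices key : ∀ γ : (s : Srt m) → Equiv.Perm (carrier G m s), γ ∈ (namedModel G m).autGroup →
      (∀ s x, supp s x ⊆ A ∩ B → γ s x = x) → γ ∈ K from fun γ hγ => key γ hγ.1 hγ.2
  intro γ hγ hfix
  obtain ⟨σ, hlow, htop⟩ := exists_perm_of_mem_autGroup hγ
  have hσ : ∀ x ∈ A ∩ B, σ x = x := by
    intro x hx
    have h1 : onLow (fun s => γ s) 0 (vertex m x) = vertex m x :=
      hfix (.low 0) _ (supp_low_subset.2 fun _ => hx)
    exact DFunLike.congr_fun ((hlow 0 (vertex m x)).symm.trans h1) 0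
  have hσK : permAut G m σ ∈ K := by
    obtain ⟨ρ, τ, hρ, hτ, hστ⟩ := exists_perm_factorization hσ
    have h1 : ρ ∈ K.comap (permAut G m) := hA (permAut_mem_fixing hρ)
    have h2 : ρ⁻¹ * τ * ρ ∈ K.comap (permAut G m) := hB (permAut_mem_fixing hτ)
    have h3 : τ⁻¹ * σ ∈ K.comap (permAut G m) := hA (permAut_mem_fixing hστ)
    have h := mul_mem (mul_mem (mul_mem h1 h2) (inv_mem h1)) h3
    have hprod : ρ * (ρ⁻¹ * τ * ρ) * ρ⁻¹ * (τ⁻¹ * σ) = σ := by group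
    rwa [hprod] at h
  have hF := isCopyOn_of_mem_autGroup hγ (A ∪ B)
  obtain ⟨f, hf, hfg, hf0⟩ := hF.isAlternating_fibreShift.exists_primitive
    (C := (A ∩ B : Finset ℕ)) (D := (A ∪ B : Finset ℕ))
    (by exact_mod_cast Finset.inter_subset_union) (fun w hw hwD => hF.sum_fibreShift hw hwD)
    (fun w hw => by
      by_cases h : Function.Injective w
      · have hw' : ∀ i, w i ∈ A ∪ B := fun i => Finset.inter_subset_union (hw i)
        refine (fibreShift_coe _ (w := ⟨w, h⟩) hw').trans ?_
        exact congrArg Prod.snd (hfix .top ((⟨w, h⟩ : Fin (m + 2) ↪ ℕ), (0 : G))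
          (supp_top_subset.2 hw))
      · exact hF.isAlternating_fibreShift.eq_zero w h)
  let δ : (s : Srt m) → Equiv.Perm (carrier G m s) :=
    autOf 1 (coboundary (cochainOf (A ∪ B) (hf.restrict (A : Set ℕ))))
  have hδK : δ ∈ K := by
    refine hB (autOf_mem_fixing (coboundary_coboundary _) (fun _ _ => rfl) fun w hw => ?_)
    rw [coboundary_cochainOf_val _ fun i => Finset.mem_union_right _ (hw i)]
    refine Finset.sum_eq_zero fun i _ => ?_
    split_ifs with h
    · rw [hf0 _ fun j => Finset.mem_coe.2 (Finset.mem_inter.2 ⟨h j, hw _⟩), smul_zero]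
    · exact smul_zero _
  have hδ := mul_mem hσK hδK
  have hγδ : (permAut G m σ * δ)⁻¹ * γ ∈ K := by
    refine hA ⟨mul_mem (inv_mem (hKaut hδ)) hγ, fun s x hx => ?_⟩
    suffices hx' : γ s x = (permAut G m σ * δ) s x from
      ((permAut G m σ * δ) s).symm_apply_eq.2 hx'
    rcases s with k | _ | _
    · exact hlow k x
    · have hxA := supp_top_subset.1 hx
      have hxD : ∀ i, (x : (Fin (m + 2) ↪ ℕ) × G).1 i ∈ A ∪ B :=
        fun i => Finset.mem_union_left _ (hxA i)
      refine Prod.ext (htop x) ((hF.onTop_snd x hxD).trans ?_)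
      refine Eq.trans (congrArg (· + _) ?_) (zero_add _).symm
      refine (hfg _ (Function.Embedding.injective _) hxD).symm.trans
        (Eq.trans ?_ (coboundary_cochainOf_val _ hxD).symm)
      exact Finset.sum_congr rfl fun i _ => congrArg _ (if_pos fun j => hxA _).symm
    · exact hF.map_grp x
  have h := mul_mem hδ hγδ
  rwa [mul_inv_cancel_left] at h

/-! ### The copies of a finite set of points are definable -/

instance (m : ℕ) : Finite (Srt m) :=
  Finite.of_injective (β := Fin (m + 1) ⊕ Bool)
    (fun s => match s with
      | .low k => Sum.inl k
      | .top => Sum.inr true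
      | .grp => Sum.inr false)
    fun s t h => by rcases s with _ | _ | _ <;> rcases t with _ | _ | _ <;> simp_all

instance (m : ℕ) : Finite (Fn m) :=
  Finite.of_injective
    (β := (Σ k : Fin m, Fin (k + 2)) ⊕ Fin (m + 2) ⊕ Bool ⊕ Equiv.Perm (Fin (m + 2)))
    (fun f => match f with
      | .projLow k i => Sum.inl ⟨k, i⟩
      | .projTop i => Sum.inr (Sum.inl i)
      | .add => Sum.inr (Sum.inr (Sum.inl true))
      | .act => Sum.inr (Sum.inr (Sum.inl false))
      | .inv σ => Sum.inr (Sum.inr (Sum.inr σ)))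
    fun f g h => by
      rcases f with ⟨k, i⟩ | _ | _ | _ | _ <;> rcases g with ⟨l, j⟩ | _ | _ | _ | _ <;>
        simp_all [Sigma.ext_iff]

theorem finite_points {G : Type} [Finite G] (D : Finset ℕ) (s : Srt m) :
    Finite {x : carrier G m s // supp s x ⊆ D} := by
  have hemb : ∀ k, Finite {w : Fin k ↪ ℕ // ∀ i, w i ∈ D} := fun k =>
    Finite.of_injective (β := Fin k → D) (fun w i => ⟨w.1 i, w.2 i⟩) fun v w h =>
      Subtype.ext (DFunLike.ext _ _ fun i => congrArg Subtype.val (congrFun h i))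
  rcases s with k | _ | _
  · have := hemb (k + 1)
    exact Finite.of_injective (β := {w : Fin (k + 1) ↪ ℕ // ∀ i, w i ∈ D})
      (fun x => ⟨x.1, supp_low_subset.1 x.2⟩) fun x y h => Subtype.ext (congrArg (fun z => z.1) h)
  · have := hemb (m + 2)
    exact Finite.of_injective (β := {w : Fin (m + 2) ↪ ℕ // ∀ i, w i ∈ D} × G)
      (fun x => (⟨Prod.fst (α := Fin (m + 2) ↪ ℕ) (β := G) x.1, supp_top_subset.1 x.2⟩,
        Prod.snd (α := Fin (m + 2) ↪ ℕ) (β := G) x.1))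
      fun x y h => Subtype.ext (Prod.ext (congrArg (fun z => z.1.1) h)
        (congrArg (fun z => z.2) h))
  · exact Finite.of_injective (β := G) (fun x => x.1) fun x y h => Subtype.ext h

/-- The points over `D` of the standard structure. -/
abbrev PointsOver (G : Type) [AddCommGroup G] (m : ℕ) (D : Finset ℕ) : Type :=
  (namedModel G m).PointsOver (supp (m := m)) D

/-- The restriction to the points over `D` of a family of maps of the sorts is a copy if and only
if it satisfies a certain formula. -/
theorem exists_formula_copy [Finite G] (D : Finset ℕ) :
    ∃ φ : (namedLanguage G m).Formula (fun p : PointsOver G m D => p.1), ∀ F,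
      φ.Holds (namedModel G m) F ↔
        ∃ γ ∈ (namedModel G m).autGroup, ∀ p, F p = γ p.1 p.2.1 := by
  classical
  let L := namedLanguage G m
  let Γ : PointsOver G m D → L.Sorts := fun p => p.1
  let Pt : L.Sorts → Type := fun s => {x : (namedModel G m).carrier s // supp (m := m) s x ⊆ D}
  have hPt : ∀ s, Finite (Pt s) := finite_points D
  have hFn : Finite L.Fn := inferInstanceAs (Finite (Fn m ⊕ G))
  let φ₁ : L.Formula Γ := Formula.iAnd
    fun q : Σ f : L.Fn, (i : Fin (L.fnArity f)) → Pt (L.fnDom f i) =>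
      Formula.eq (.func q.1 fun i => .var (Γ := Γ) ⟨L.fnDom q.1 i, q.2 i⟩)
        (.var (Γ := Γ) ⟨L.fnCod q.1, (namedModel G m).funMap q.1 fun i => (q.2 i).1,
          supp_funMap_subset q.1 _ fun i => (q.2 i).2⟩)
  have hTop : Finite (Pt Srt.top) := hPt _
  have hLow : Finite (Pt (Srt.low 0)) := hPt _
  let φ₂ : L.Formula Γ := Formula.iAnd
    fun q : {x : Fin (m + 3) → Pt Srt.top // QRel (G := G) (m := m) fun i => (x i).1} =>
      Formula.rel (L := L) () fun i => .var (Γ := Γ) ⟨Srt.top, q.1 i⟩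
  let φ₃ : L.Formula Γ := Formula.iAnd
    fun q : {x : Pt (Srt.low 0) × Pt (Srt.low 0) // x.1 ≠ x.2} =>
      (Formula.eq (s := (Srt.low 0 : Srt m)) (.var (Γ := Γ) ⟨Srt.low 0, q.1.1⟩)
        (.var (Γ := Γ) ⟨Srt.low 0, q.1.2⟩)).not
  have hφ : ∀ F, (φ₁.and (φ₂.and φ₃)).Holds (namedModel G m) F ↔
      (∀ q : Σ f : L.Fn, (i : Fin (L.fnArity f)) → Pt (L.fnDom f i),
        (namedModel G m).funMap q.1 (fun i => F ⟨_, q.2 i⟩) =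
          F ⟨_, _, supp_funMap_subset q.1 (fun i => (q.2 i).1) fun i => (q.2 i).2⟩) ∧
      (∀ q : {x : Fin (m + 3) → Pt Srt.top // QRel (G := G) (m := m) fun i => (x i).1},
        QRel (G := G) (m := m) fun i => F ⟨Srt.top, q.1 i⟩) ∧
      ∀ q : {x : Pt (Srt.low 0) × Pt (Srt.low 0) // x.1 ≠ x.2},
        F ⟨Srt.low 0, q.1.1⟩ ≠ F ⟨Srt.low 0, q.1.2⟩ := fun F =>
    (Formula.holds_and _ _ _ _).trans (and_congr
      ((Formula.holds_iAnd _ _ _).trans (forall_congr' fun _ => Formula.holds_eq _ _ _ _))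
      ((Formula.holds_and _ _ _ _).trans (and_congr
        ((Formula.holds_iAnd _ _ _).trans (forall_congr' fun _ => Formula.holds_rel _ _ _ _))
        ((Formula.holds_iAnd _ _ _).trans (forall_congr' fun _ =>
          (Formula.holds_not _ _ _).trans (not_congr (Formula.holds_eq _ _ _ _)))))))
  refine ⟨φ₁.and (φ₂.and φ₃), fun F => (hφ F).trans ⟨?_, ?_⟩⟩
  · rintro ⟨hfn, hrel, hinj⟩
    let F' : (s : Srt m) → carrier G m s → carrier G m s := fun s x =>
      if h : supp s x ⊆ D then F ⟨s, x, h⟩ else x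
    have hF' : ∀ s x (h : supp s x ⊆ D), F' s x = F ⟨s, x, h⟩ := fun s x h => dif_pos h
    have hcopy : IsCopyOn D F' := by
      refine ⟨fun f x hx => ?_, fun x hx hQ => ?_, fun v w hv hw h => ?_⟩
      · refine (hF' _ _ (supp_funMap_subset f x hx)).trans
          ((hfn ⟨f, fun i => ⟨x i, hx i⟩⟩).symm.trans ?_)
        exact congrArg _ (funext fun i => (hF' _ _ (hx i)).symm)
      · have h : (fun i => F' .top (x i)) = fun i => F ⟨Srt.top, x i, hx i⟩ :=
          funext fun i => hF' _ _ (hx i)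
        rw [h]
        exact hrel ⟨fun i => ⟨x i, hx i⟩, hQ⟩
      · rw [hF' _ _ hv, hF' _ _ hw] at h
        by_contra hvw
        exact hinj ⟨(⟨v, hv⟩, ⟨w, hw⟩), fun h => hvw (congrArg Subtype.val h)⟩ h
    obtain ⟨γ, hγ, h⟩ := hcopy.exists_aut
    exact ⟨γ, hγ, fun p => (hF' p.1 p.2.1 p.2.2).symm.trans (h p.1 p.2.1 p.2.2)⟩
  · rintro ⟨γ, hγ, hF⟩
    obtain rfl : F = fun p : PointsOver G m D => γ p.1 p.2.1 := funext hF
    refine ⟨fun q => (hγ.1 _ _).symm, fun q => (hγ.2 () _).2 q.2, fun q h => q.2 ?_⟩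
    exact Subtype.ext ((γ _).injective h)

/-- Tuples of given sorts have supports of bounded size, so permutations of the vertices move all
of them over one finite set. -/
theorem exists_aut_supp_subset (k : ℕ) (Γ : Fin k → Srt m) :
    ∃ D : Finset ℕ, ∀ a : (i : Fin k) → carrier G m (Γ i), ∃ γ ∈ (namedModel G m).autGroup,
      ∀ i, supp _ (γ _ (a i)) ⊆ D := by
  classical
  refine ⟨Finset.range (k * (m + 2)), fun a => ?_⟩
  have hcard : ∀ s (x : carrier G m s), (supp s x).card ≤ m + 2 := by
    intro s x
    rcases s with k | _ | _
    · have hk := k.2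
      have : (supp (G := G) (.low k) x).card = k + 1 :=
        (Finset.card_map _).trans (Finset.card_fin _)
      omega
    · simp [supp]
    · simp [supp]
  let S : Finset ℕ := Finset.univ.biUnion fun i => supp _ (a i)
  have hS : S.card ≤ k * (m + 2) := by
    simpa using Finset.card_biUnion_le_card_mul Finset.univ (fun i => supp _ (a i)) (m + 2)
      fun i _ => hcard _ _
  let e := S.equivFin
  obtain ⟨σ, hσ⟩ := exists_perm_eqOn (S := S) (f := fun x => if h : x ∈ S then e ⟨x, h⟩ else 0) (by
    intro x hx y hy hxy
    simp only [dif_pos (Finset.mem_coe.1 hx), dif_pos (Finset.mem_coe.1 hy)] at hxy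
    exact congrArg Subtype.val (e.injective (Fin.ext hxy)))
  have hσ' : ∀ i, ∀ x ∈ supp _ (a i), σ x ∈ Finset.range (k * (m + 2)) := by
    intro i x hx
    have hxS : x ∈ S := Finset.mem_biUnion.2 ⟨i, Finset.mem_univ _, hx⟩
    rw [hσ x hxS, dif_pos hxS]
    exact Finset.mem_range.2 ((e ⟨x, hxS⟩).2.trans_le hS)
  refine ⟨permAut G m σ, autOf_mem_autGroup σ coboundary_zero, fun i => ?_⟩
  have hsupp : ∀ s (x : carrier G m s), supp s (permAut G m σ s x) =
      (supp s x).map σ.toEmbedding := by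
    intro s x
    rcases s with k | _ | _
    · exact (Finset.map_map _ _ _).symm
    · exact (Finset.map_map _ _ _).symm
    · rfl
  refine (hsupp _ _).subset.trans fun y hy => ?_
  obtain ⟨x, hx, rfl⟩ := Finset.mem_map.1 hy
  exact hσ' i x hx

end Polygroupoid

theorem mainTheorem8 (G : Type) [AddCommGroup G] [Finite G] [Nontrivial G] (m : ℕ) :
    MSLanguage.Theory.WeakElimImaginaries.{u} (Polygroupoid.namedTheory G m) := by
  refine MSLanguage.weakElimImaginaries_of_support (H := Polygroupoid.namedModel G m)
    (supp := Polygroupoid.supp (m := m)) (fun D => ?_) Polygroupoid.exists_formula_copy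
    Polygroupoid.exists_aut_supp_subset (fun _ => Polygroupoid.exists_perm_supp)
    Polygroupoid.fixing_inter_le
  have : Finite (Polygroupoid.namedLanguage G m).Sorts :=
    inferInstanceAs (Finite (Polygroupoid.Srt m))
  have (s : (Polygroupoid.namedLanguage G m).Sorts) :
      Finite {x : (Polygroupoid.namedModel G m).carrier s //
        Polygroupoid.supp (m := m) s x ⊆ D} := Polygroupoid.finite_points D s
  exact inferInstanceAs (Finite (Σ s : (Polygroupoid.namedLanguage G m).Sorts,
    {x : (Polygroupoid.namedModel G m).carrier s // Polygroupoid.supp (m := m) s x ⊆ D}))
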